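/- Let $G$ be a second-countable, locally compact (Hausdorff), unimodular, amenable group with Haar measure $\mu_G$, and let $Q\subseteq G$ be a compact symmetric neighbourhood of the identity. A *strong Følner sequence* is a sequence $(K_n)_{n\in\mathbb N}$ of compact subsets of $G$ of positive measure such that, for every nonempty compact $K\subseteq G$, $$\lim_{n\to\infty}\frac{\mu_G(K_nK\,\triangle\,K_n)}{\mu_G(K_n)}=0\quad\text{and}\quad \lim_{n\to\infty}\frac{\mu_G(K_nK\cap K_n^cK)}{\mu_G(K_n)}=0 .$$ For a discrete set $\Lambda\subseteq G$ put $$D^-(\Lambda)=\lim_{n\to\infty}\inf_{x\in G}\frac{\#(\Lambda\cap xK_n)}{\mu_G(K_n)},\qquad D^+(\Lambda)=\lim_{n\to\infty}\sup_{x\in G}\frac{\#(\Lambda\cap xK_n)}{\mu_G(K_n)},$$ where $(K_n)$ is any strong Følner sequence (the values do not depend on the choice). Let $(\pi,\mathcal H_\pi)$ be a discrete series projective representation of $G$: a strongly measurable map $\pi$ from $G$ to the unitary operators of a complex Hilbert space $\mathcal H_\pi$ with $\pi(xy)=\sigma(x,y)\pi(x)\pi(y)$ for some $\sigma:G\times G\to\mathbb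 T$, irreducible (no closed invariant subspaces other than $\{0\}$ and $\mathcal H_\pi$), and such that $\int_G|\langle g,\pi(x)g\rangle|^2\,d\mu_G(x)<\infty$ for some $g\neq0$. Its formal degree is the number $d_\pi>0$ with $$\int_G\langle f_1,\pi(x)g_1\rangle\langle\pi(x)g_2,f_2\rangle\,d\mu_G(x)=d_\pi^{-1}\langle f_1,f_2\rangle\overline{\langle g_1,g_2\rangle}\qquad\text{for all }f_1,f_2,g_1,g_2\in\mathcal H_\pi .$$ Write $V_gg(x)=\langle g,\pi(x)g\rangle$, and let $\mathcal B^2_\pi$ be the set of $g\in\mathcal H_\pi$ for which the local maximal function $x\mapsto\operatorname{ess\,sup}_{z\in Q}|V_gg(xz)|$ belongs to $L^2(G)$. For $\Lambda\subseteq G$, the family $(\pi(\lambda)g)_{\lambda\in\Lambda}$ is a frame for $\mathcal H_\pi$ if there are constants $A,B>0$ with $A\|f\|^2\le\sum_{\lambda\in\Lambda}|\langle f,\pi(\lambda)g\rangle|^2\le B\|f\|^2$ for all $f\in\mathcal H_\pi$. **Proposition.** Let $\Lambda\subseteq G$ be discrete and $g\in\mathcal B^2_\pi$, and suppose that $(\pi(\lambda)g)_{\lambda\in\Lambda}$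 is a frame for $\mathcal H_\pi$. If there exists a subset $\Gamma\subseteq\Lambda$ with $D^-(\Gamma)>0$ such that $(\pi(\lambda)g)_{\lambda\in\Lambda\setminus\Gamma}$ is a frame for $\mathcal H_\pi$, then $D^+(\Lambda)>d_\pi$. -/

import Mathlib

open MeasureTheory Filter
open scoped Pointwise ENNReal Topology ComplexConjugate

noncomputable section

namespace CoherentFrame

/-! ### Strong Folner sequences and Beurling densities -/

section Density

variable {G : Type*} [Group G] [TopologicalSpace G] [MeasurableSpace G]

/-- A (right) Folner sequence: compact sets of positive measure with
`μ (Kₙ C ∆ Kₙ) / μ Kₙ → 0` for every nonempty compact `C`.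
(For `C = ∅` the quotient is constantly `1`, so the empty set has to be left out.) -/
structure IsFolner (μ : Measure G) (K : ℕ → Set G) : Prop where
  isCompact : ∀ n, IsCompact (K n)
  measure_ne_zero : ∀ n, μ (K n) ≠ 0
  tendsto : ∀ C : Set G, IsCompact C → C.Nonempty →
    Tendsto (fun n => μ (symmDiff (K n * C) (K n)) / μ (K n)) atTop (𝓝 0)

/-- A (right) strong Folner sequence: a Folner sequence for which moreover
`μ (Kₙ C ∩ Kₙᶜ C) / μ Kₙ → 0` for every compact `C`. -/
structure IsStrongFolner (μ : Measure G) (K : ℕ → Set G) : Prop extends IsFolner μ K where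
  tendsto_boundary : ∀ C : Set G, IsCompact C →
    Tendsto (fun n => μ ((K n * C) ∩ ((K n)ᶜ * C)) / μ (K n)) atTop (𝓝 0)

/-- The lower Beurling density of `Λ` along `K`, with value in `[0, ∞]`:
the limit of `inf_x #(Λ ∩ x Kₙ) / μ Kₙ` as `n → ∞`, written as a limit inferior so that no
convergence is presupposed. -/
def lowerBeurlingDensity (μ : Measure G) (K : ℕ → Set G) (Λ : Set G) : ℝ≥0∞ :=
  liminf (fun n => ⨅ x : G, ((Λ ∩ x • K n).encard : ℝ≥0∞) / μ (K n)) atTop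

/-- The upper Beurling density of `Λ` along `K`, with value in `[0, ∞]`:
the limit of `sup_x #(Λ ∩ x Kₙ) / μ Kₙ` as `n → ∞`, written as a limit superior so that no
convergence is presupposed. -/
def upperBeurlingDensity (μ : Measure G) (K : ℕ → Set G) (Λ : Set G) : ℝ≥0∞ :=
  limsup (fun n => ⨆ x : G, ((Λ ∩ x • K n).encard : ℝ≥0∞) / μ (K n)) atTop

/-- The left local maximal function `M^L F (x) = ess sup_{z ∈ Q} |F (x z)|`. -/
def leftLocalMax (μ : Measure G) (Q : Set G) (F : G → ℂ) (x : G) : ℝ≥0∞ :=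
  essSup (fun z => ‖F (x * z)‖ₑ) (μ.restrict Q)

/-- Membership in the Wiener amalgam space `W^L (L^p)`: the function `F` is locally essentially
bounded and `M^L F` belongs to `L^p`. -/
def MemWienerAmalgam (μ : Measure G) (Q : Set G) (p : ℝ≥0∞) (F : G → ℂ) : Prop :=
  (∀ C : Set G, IsCompact C → MemLp F ∞ (μ.restrict C)) ∧ MemLp (leftLocalMax μ Q F) p μ

end Density

/-! ### Frames -/

/-- A family `v` in a Hilbert space is a frame if there are `A, B > 0` with
`A ‖f‖² ≤ ∑ᵢ |⟨f, vᵢ⟩|² ≤ B ‖f‖²` for all `f`. -/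
def IsFrame {H : Type*} [NormedAddCommGroup H] [InnerProductSpace ℂ H] {ι : Type*}
    (v : ι → H) : Prop :=
  ∃ A B : ℝ, 0 < A ∧ 0 < B ∧ ∀ f : H,
    Summable (fun i => ‖inner ℂ (v i) f‖ ^ 2) ∧
    A * ‖f‖ ^ 2 ≤ ∑' i, ‖inner ℂ (v i) f‖ ^ 2 ∧
    ∑' i, ‖inner ℂ (v i) f‖ ^ 2 ≤ B * ‖f‖ ^ 2

/-! ### Projective unitary representations -/

/-- A projective unitary representation of `G` on `H`: a strongly measurable family of unitary
operators with `π (x y) = σ (x, y) π (x) π (y)` for a function `σ` with values in the circle. -/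
structure ProjectiveRep (G H : Type*) [Group G] [MeasurableSpace G]
    [NormedAddCommGroup H] [InnerProductSpace ℂ H] where
  /-- The unitary operators. -/
  op : G → H ≃ₗᵢ[ℂ] H
  /-- The multiplier. -/
  cocycle : G → G → Circle
  op_mul : ∀ (x y : G) (f : H), op (x * y) f = (cocycle x y : ℂ) • op x (op y f)
  stronglyMeasurable : ∀ f : H, StronglyMeasurable (fun x => op x f)

namespace ProjectiveRep

variable {G H : Type*} [Group G] [TopologicalSpace G] [MeasurableSpace G]
  [NormedAddCommGroup H] [InnerProductSpace ℂ H]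

/-- The coefficient transform `V_g f (x) = ⟨f, π (x) g⟩`, where `⟨·, ·⟩` is linear in the first
variable (in Mathlib the inner product is linear in the second one). -/
def coeff (π : ProjectiveRep G H) (g f : H) (x : G) : ℂ := inner ℂ (π.op x g) f

/-- The only closed invariant subspaces are `{0}` and the whole space. -/
def IsIrreducible (π : ProjectiveRep G H) : Prop :=
  ∀ M : Submodule ℂ H, IsClosed (M : Set H) → (∀ (x : G), ∀ f ∈ M, π.op x f ∈ M) →
    M = ⊥ ∨ M = ⊤

/-- A discrete series (square-integrable) representation: irreducible, and `V_g g ∈ L²` for some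
nonzero `g`. -/
def IsDiscreteSeries (π : ProjectiveRep G H) (μ : Measure G) : Prop :=
  π.IsIrreducible ∧ ∃ g : H, g ≠ 0 ∧ MemLp (π.coeff g g) 2 μ

/-- The positive number `d` satisfies the orthogonality relations
`∫ ⟨f₁, π(x) g₁⟩ ⟨π(x) g₂, f₂⟩ dμ(x) = d⁻¹ ⟨f₁, f₂⟩ conj ⟨g₁, g₂⟩`. -/
def IsFormalDegree (π : ProjectiveRep G H) (μ : Measure G) (d : ℝ) : Prop :=
  0 < d ∧ ∀ f₁ f₂ g₁ g₂ : H,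
    Integrable (fun x => inner ℂ (π.op x g₁) f₁ * inner ℂ f₂ (π.op x g₂)) μ ∧
    ∫ x, inner ℂ (π.op x g₁) f₁ * inner ℂ f₂ (π.op x g₂) ∂μ =
      (d : ℂ)⁻¹ * inner ℂ f₂ f₁ * conj (inner ℂ g₂ g₁)

open Classical in
/-- The formal degree `d_π`: the positive number for which the orthogonality relations hold.
For a discrete series representation of a unimodular group it exists and is unique; the value `0`
is a default for other representations. -/
def formalDegree (π : ProjectiveRep G H) (μ : Measure G) : ℝ :=
  if h : ∃ d : ℝ, π.IsFormalDegree μ d then h.choose else 0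

/-- The space `B²_π` of vectors `g` with `V_g g ∈ W^L (L²)`. -/
def B2 (π : ProjectiveRep G H) (μ : Measure G) (Q : Set G) : Set H :=
  {g | MemWienerAmalgam μ Q 2 (π.coeff g g)}

/-- The coherent system `π (Λ) g = (π (λ) g)_{λ ∈ Λ}`. -/
def coherentSystem (π : ProjectiveRep G H) (Λ : Set G) (g : H) : Λ → H :=
  fun l => π.op (l : G) g

end ProjectiveRep

end CoherentFrame

end

/-!
The diagonal `⟨h_l, π(l) g⟩` of the canonical dual frame `h` lies in `[0, 1]`, and it stays below
some `1 - ε` on `Γ` because the vectors indexed by `Γ` can be removed. Integrating the frame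
expansion of `π(x) g` over `x ∈ K n` and using the orthogonality relations, the mean of this
diagonal over `Λ ∩ K n` (with respect to `μ (K n)`) is asymptotically at least `d_π`: membership of
`g` in `B²_π` localizes the expansion, so that the strong Følner condition makes the boundary terms
negligible. Hence `d_π ≤ D⁺(Λ) - ε D⁻(Γ) < D⁺(Λ)`.
-/

namespace CoherentFrame

section Frames

variable {H : Type*} [NormedAddCommGroup H] [InnerProductSpace ℂ H] {ι κ : Type*} {v : ι → H}

namespace IsFrame

theorem summable (hv : IsFrame v) (f : H) : Summable fun i => ‖inner ℂ (v i) f‖ ^ 2 :=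
  let ⟨_, _, _, _, h⟩ := hv
  (h f).1

theorem exists_mul_norm_sq_le (hv : IsFrame v) :
    ∃ A > 0, ∀ f, A * ‖f‖ ^ 2 ≤ ∑' i, ‖inner ℂ (v i) f‖ ^ 2 :=
  let ⟨A, _, hA, _, h⟩ := hv
  ⟨A, hA, fun f => (h f).2.1⟩

theorem exists_tsum_enorm_inner_sq_le (hv : IsFrame v) :
    ∃ B : ℝ≥0∞, B ≠ ∞ ∧ ∀ f, ∑' i, ‖inner ℂ (v i) f‖ₑ ^ 2 ≤ B * ‖f‖ₑ ^ 2 := by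
  obtain ⟨_, B, -, hB, h⟩ := hv
  refine ⟨ENNReal.ofReal B, ENNReal.ofReal_ne_top, fun f => ?_⟩
  calc ∑' i, ‖inner ℂ (v i) f‖ₑ ^ 2 = ∑' i, ENNReal.ofReal (‖inner ℂ (v i) f‖ ^ 2) := by
        simp only [ENNReal.ofReal_pow (norm_nonneg _), ofReal_norm]
    _ = ENNReal.ofReal (∑' i, ‖inner ℂ (v i) f‖ ^ 2) :=
        (ENNReal.ofReal_tsum_of_nonneg (fun _ => sq_nonneg _) (h f).1).symm
    _ ≤ ENNReal.ofReal (B * ‖f‖ ^ 2) := ENNReal.ofReal_le_ofReal (h f).2.2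
    _ = ENNReal.ofReal B * ‖f‖ₑ ^ 2 := by
        rw [ENNReal.ofReal_mul hB.le, ENNReal.ofReal_pow (norm_nonneg _), ofReal_norm]

theorem exists_ne_zero [Nontrivial H] (hv : IsFrame v) : ∃ i, v i ≠ 0 := by
  obtain ⟨A, hA, h⟩ := hv.exists_mul_norm_sq_le
  obtain ⟨f, hf⟩ := exists_ne (0 : H)
  by_contra! h0
  have hle : A * ‖f‖ ^ 2 ≤ 0 := by simpa [h0] using h f
  exact hle.not_gt (by positivity)

/-- The analysis operator `f ↦ (⟨f, vᵢ⟩)ᵢ` of a frame, with values in `ℓ²`. -/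
noncomputable def analysis (hv : IsFrame v) : H →L[ℂ] lp (fun _ : ι => ℂ) 2 :=
  LinearMap.mkContinuousOfExistsBound
    { toFun f := ⟨fun i => inner ℂ (v i) f, memℓp_gen (by simpa using hv.summable f)⟩
      map_add' _ _ := by ext; exact inner_add_right _ _ _
      map_smul' _ _ := by ext; exact inner_smul_right _ _ _ } <| by
    obtain ⟨_, B, -, hB, h⟩ := hv
    refine ⟨√B, fun f => le_of_sq_le_sq ?_ (by positivity)⟩
    rw [mul_pow, Real.sq_sqrt hB.le, ← Real.rpow_natCast]
    refine Eq.trans_le ?_ (h f).2.2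
    simpa using lp.norm_rpow_eq_tsum (p := 2) (by norm_num) _

@[simp]
theorem analysis_apply (hv : IsFrame v) (f : H) (i : ι) : hv.analysis f i = inner ℂ (v i) f := rfl

theorem norm_analysis_sq (hv : IsFrame v) (f : H) :
    ‖hv.analysis f‖ ^ 2 = ∑' i, ‖inner ℂ (v i) f‖ ^ 2 := by
  simpa using lp.norm_rpow_eq_tsum (p := 2) (by norm_num) (hv.analysis f)

variable [CompleteSpace H]

/-- The frame operator `f ↦ ∑ᵢ ⟨f, vᵢ⟩ vᵢ`. -/
noncomputable def frameOperator (hv : IsFrame v) : H →L[ℂ] H :=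
  ContinuousLinearMap.adjoint hv.analysis ∘L hv.analysis

theorem inner_frameOperator_right (hv : IsFrame v) (f f' : H) :
    inner ℂ f (hv.frameOperator f') = inner ℂ (hv.analysis f) (hv.analysis f') :=
  ContinuousLinearMap.adjoint_inner_right hv.analysis f (hv.analysis f')

theorem isSelfAdjoint_frameOperator (hv : IsFrame v) : IsSelfAdjoint hv.frameOperator :=
  hv.analysis.isPositive_adjoint_comp_self.isSelfAdjoint

theorem isUnit_frameOperator (hv : IsFrame v) : IsUnit hv.frameOperator := by
  obtain ⟨A, hA, h⟩ := hv.exists_mul_norm_sq_le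
  refine ContinuousLinearMap.isUnit_of_forall_le_norm_inner_map _ (c := A.toNNReal)
    (Real.toNNReal_pos.2 hA) fun f => ?_
  rw [Real.coe_toNNReal _ hA.le, norm_inner_symm, inner_frameOperator_right,
    inner_self_eq_norm_sq_to_K, norm_pow, RCLike.norm_ofReal, abs_norm, norm_analysis_sq, mul_comm]
  exact h f

/-- The canonical dual frame `hᵢ = S⁻¹ vᵢ`, where `S` is the frame operator. -/
noncomputable def canonicalDual (hv : IsFrame v) (i : ι) : H := Ring.inverse hv.frameOperator (v i)

theorem frameOperator_inverse_apply (hv : IsFrame v) (f : H) :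
    hv.frameOperator (Ring.inverse hv.frameOperator f) = f :=
  DFunLike.congr_fun (Ring.mul_inverse_cancel _ hv.isUnit_frameOperator) f

theorem inner_canonicalDual (hv : IsFrame v) (i : ι) (f : H) :
    inner ℂ (hv.canonicalDual i) f = inner ℂ (v i) (Ring.inverse hv.frameOperator f) :=
  hv.isSelfAdjoint_frameOperator.ringInverse.isSymmetric (v i) f

theorem exists_tsum_enorm_inner_canonicalDual_sq_le (hv : IsFrame v) :
    ∃ B : ℝ≥0∞, B ≠ ∞ ∧ ∀ f, ∑' i, ‖inner ℂ (hv.canonicalDual i) f‖ₑ ^ 2 ≤ B * ‖f‖ₑ ^ 2 := by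
  obtain ⟨B, hB, h⟩ := hv.exists_tsum_enorm_inner_sq_le
  refine ⟨B * ‖Ring.inverse hv.frameOperator‖ₑ ^ 2, by finiteness, fun f => ?_⟩
  simp only [inner_canonicalDual, mul_assoc, ← mul_pow]
  exact (h _).trans (by gcongr; exact ContinuousLinearMap.le_opENorm _ _)

theorem hasSum_inner_mul_inner_canonicalDual (hv : IsFrame v) (f : H) :
    HasSum (fun i => inner ℂ f (v i) * inner ℂ (hv.canonicalDual i) f) (‖f‖ ^ 2 : ℂ) := by
  have h := lp.hasSum_inner (𝕜 := ℂ) (hv.analysis f) (hv.analysis (Ring.inverse hv.frameOperator f))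
  rw [← inner_frameOperator_right, frameOperator_inverse_apply, inner_self_eq_norm_sq_to_K] at h
  refine h.congr_fun fun i => ?_
  simp [inner_canonicalDual, mul_comm]

theorem norm_inner_canonicalDual_self (hv : IsFrame v) (i : ι) :
    ‖inner ℂ (hv.canonicalDual i) (v i)‖ = ∑' j, ‖inner ℂ (v j) (hv.canonicalDual i)‖ ^ 2 := by
  rw [← hv.frameOperator_inverse_apply (v i), inner_frameOperator_right, ← norm_analysis_sq,
    ← canonicalDual, inner_self_eq_norm_sq_to_K, norm_pow, RCLike.norm_ofReal, abs_norm]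

theorem norm_inner_canonicalDual_self_le_one (hv : IsFrame v) (i : ι) :
    ‖inner ℂ (hv.canonicalDual i) (v i)‖ ≤ 1 := by
  have hsq : ‖inner ℂ (hv.canonicalDual i) (v i)‖ ^ 2 ≤ ‖inner ℂ (hv.canonicalDual i) (v i)‖ := by
    nth_rw 1 [norm_inner_symm]
    rw [hv.norm_inner_canonicalDual_self]
    exact (hv.summable _).le_tsum i fun _ _ => sq_nonneg _
  nlinarith

theorem add_sq_norm_le_norm_inner_canonicalDual_self (hv : IsFrame v) {e : κ → ι}
    (he : e.Injective) {A : ℝ}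
    (hA : ∀ f, A * ‖f‖ ^ 2 ≤ ∑' k, ‖inner ℂ (v (e k)) f‖ ^ 2) {i : ι} (hi : i ∉ Set.range e) :
    ‖inner ℂ (hv.canonicalDual i) (v i)‖ ^ 2 + A * ‖hv.canonicalDual i‖ ^ 2 ≤
      ‖inner ℂ (hv.canonicalDual i) (v i)‖ := by
  classical
  have hsum := hv.summable (hv.canonicalDual i)
  have hsum' := hsum.summable_of_eq_zero_or_self (g := fun j => if j = i then 0 else
    ‖inner ℂ (v j) (hv.canonicalDual i)‖ ^ 2) fun j => by split_ifs <;> simp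
  conv_rhs => rw [norm_inner_canonicalDual_self]
  rw [hsum.tsum_eq_add_tsum_ite i, norm_inner_symm]
  gcongr
  refine (hA _).trans (Eq.trans_le ?_ (tsum_comp_le_tsum_of_inj hsum' ?_ he))
  · refine tsum_congr fun k => (if_neg ?_).symm
    exact fun hk => hi ⟨k, hk⟩
  · intro j
    positivity

theorem exists_lt_one_norm_inner_canonicalDual_self_le (hv : IsFrame v) {e : κ → ι}
    (he : e.Injective) (hve : IsFrame (v ∘ e)) {r : ℝ} (hr : ∀ i, ‖v i‖ ≤ r) :
    ∃ ρ < 1, ∀ i ∉ Set.range e, ‖inner ℂ (hv.canonicalDual i) (v i)‖ ≤ ρ := by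
  obtain ⟨A, hA, h⟩ := hve.exists_mul_norm_sq_le
  refine ⟨r ^ 2 / (r ^ 2 + A), (div_lt_one (by positivity)).2 (by linarith), fun i hi => ?_⟩
  have hle := hv.add_sq_norm_le_norm_inner_canonicalDual_self he h hi
  have hcs : ‖inner ℂ (hv.canonicalDual i) (v i)‖ ≤ ‖hv.canonicalDual i‖ * r :=
    (norm_inner_le_norm _ _).trans (by gcongr; exact hr i)
  set a := ‖inner ℂ (hv.canonicalDual i) (v i)‖
  have ha : 0 ≤ a := norm_nonneg _
  have hsq : a * ((r ^ 2 + A) * a) ≤ a * r ^ 2 := by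
    have := mul_le_mul_of_nonneg_left hle (sq_nonneg r)
    have := mul_le_mul_of_nonneg_left (pow_le_pow_left₀ ha hcs 2) hA.le
    linarith
  rw [le_div_iff₀ (by positivity), mul_comm]
  rcases ha.eq_or_lt with h0 | h0
  · rw [← h0, mul_zero]
    positivity
  · exact le_of_mul_le_mul_left hsq h0

end IsFrame

end Frames

theorem tsum_indicator_one_eq_encard {α : Type*} (Λ S : Set α) :
    ∑' l : Λ, S.indicator (1 : α → ℝ≥0∞) l = ((Λ ∩ S).encard : ℝ≥0∞) := by
  rw [tsum_subtype Λ (S.indicator (1 : α → ℝ≥0∞)), Set.indicator_indicator,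
    ← tsum_subtype (Λ ∩ S) (1 : α → ℝ≥0∞)]
  exact ENNReal.tsum_set_one _

theorem encard_inter_union_le {α : Type*} (Λ S T : Set α) :
    ((Λ ∩ (S ∪ T)).encard : ℝ≥0∞) ≤ (Λ ∩ S).encard + (Λ ∩ T).encard := by
  rw [Set.inter_union_distrib_left, ← ENat.toENNReal_add, ENat.toENNReal_le]
  exact Set.encard_union_le _ _

section Boundary

variable {G : Type*} [Group G] {K C D : Set G}

/-- The `C`-boundary `K C ∩ Kᶜ C` of `K`, the set that occurs in the definition of a strong Folner
sequence. -/
def boundaryLayer (K C : Set G) : Set G := (K * C) ∩ (Kᶜ * C)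

theorem boundaryLayer_mul_subset : boundaryLayer K C * D ⊆ boundaryLayer K (C * D) := by
  rw [boundaryLayer, boundaryLayer, ← mul_assoc, ← mul_assoc]
  exact Set.inter_mul_subset

theorem mul_subset_union_boundaryLayer (h : 1 ∈ C) : K * C ⊆ K ∪ boundaryLayer K C := by
  intro x hx
  by_cases hxK : x ∈ K
  · exact Or.inl hxK
  · exact Or.inr ⟨hx, x, hxK, 1, h, mul_one x⟩

end Boundary

section Folner

variable {G : Type*} [Group G] [TopologicalSpace G] [MeasurableSpace G] {μ : Measure G}
  [IsFiniteMeasureOnCompacts μ]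

theorem IsStrongFolner.le_liminf_div {K : ℕ → Set G} (hK : IsStrongFolner μ K) {D : Set G}
    (hD : IsCompact D) {R a : ℝ≥0∞} (hR : R ≠ ∞) {F : ℕ → ℝ≥0∞}
    (h : ∀ n, a * μ (K n) ≤ F n + R * μ (boundaryLayer (K n) D)) :
    a ≤ liminf (fun n => F n / μ (K n)) atTop := by
  have hlim : Tendsto (fun n => R * (μ (boundaryLayer (K n) D) / μ (K n))) atTop (𝓝 0) := by
    simpa only [boundaryLayer, mul_zero] using
      ENNReal.Tendsto.const_mul (hK.tendsto_boundary D hD) (Or.inr hR)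
  calc a ≤ liminf (fun n => F n / μ (K n) + R * (μ (boundaryLayer (K n) D) / μ (K n))) atTop := by
        refine le_liminf_of_le (by isBoundedDefault) (Eventually.of_forall fun n => ?_)
        rw [← mul_div_assoc, ← ENNReal.add_div, ENNReal.le_div_iff_mul_le
          (Or.inl (hK.measure_ne_zero n)) (Or.inl (hK.isCompact n).measure_lt_top.ne)]
        exact h n
    _ = liminf (fun n => F n / μ (K n)) atTop := ENNReal.liminf_add_of_right_tendsto_zero hlim _

end Folner

section RelativelySeparated

/-- Integrating the number of `l ∈ Λ` with `w ∈ x l E⁻¹` against `ν`. -/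
theorem tsum_measure_smul_inv_le {G : Type*} [Group G] [MeasurableSpace G] [MeasurableInv G]
    [MeasurableConstSMul G G] (ν : Measure G) {Λ E : Set G} (hE : MeasurableSet E) {N : ℝ≥0∞}
    (hN : ∀ y : G, ((Λ ∩ y • E).encard : ℝ≥0∞) ≤ N) (x : G) :
    ∑' l : Λ, ν ((x * l) • E⁻¹) ≤ N * ν Set.univ := by
  classical
  have hEm (l : Λ) : MeasurableSet ((x * l) • E⁻¹) := hE.inv.const_smul _
  have hcount (w : G) : ∑' l : Λ, ((x * l) • E⁻¹).indicator (1 : G → ℝ≥0∞) w ≤ N := by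
    refine le_trans (le_of_eq ?_) (hN (x⁻¹ * w))
    rw [← tsum_indicator_one_eq_encard]
    refine tsum_congr fun l => ?_
    simp only [Set.indicator_apply, Set.mem_smul_set_iff_inv_smul_mem, Set.mem_inv, smul_eq_mul,
      mul_inv_rev, inv_inv, mul_assoc, Pi.one_apply]
  refine ENNReal.summable.tsum_le_of_sum_le fun s => ?_
  calc ∑ l ∈ s, ν ((x * l) • E⁻¹) = ∑ l ∈ s, ∫⁻ w, ((x * l) • E⁻¹).indicator 1 w ∂ν :=
        Finset.sum_congr rfl fun l _ => (lintegral_indicator_one (hEm l)).symm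
    _ = ∫⁻ w, ∑ l ∈ s, ((x * l) • E⁻¹).indicator 1 w ∂ν :=
        (lintegral_finsetSum _ fun l _ => measurable_one.indicator (hEm l)).symm
    _ ≤ ∫⁻ _, N ∂ν := lintegral_mono fun w => (ENNReal.sum_le_tsum s).trans (hcount w)
    _ = N * ν Set.univ := lintegral_const N

variable {G : Type*} [Group G] [TopologicalSpace G] [MeasurableSpace G] {μ : Measure G}
  {Λ Γ : Set G}

/-- `Λ` is relatively separated if the translates of some compact set of positive measure contain
a bounded number of points of `Λ`. -/
def IsRelativelySeparated (μ : Measure G) (Λ : Set G) : Prop :=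
  ∃ E, IsCompact E ∧ μ E ≠ 0 ∧ ∃ N : ℝ≥0∞, N ≠ ∞ ∧ ∀ x : G, ((Λ ∩ x • E).encard : ℝ≥0∞) ≤ N

theorem IsRelativelySeparated.mono (hΛ : IsRelativelySeparated μ Λ) (h : Γ ⊆ Λ) :
    IsRelativelySeparated μ Γ :=
  let ⟨E, hE, hE0, N, hN, hb⟩ := hΛ
  ⟨E, hE, hE0, N, hN, fun x => le_trans (by gcongr) (hb x)⟩

variable [IsTopologicalGroup G] [T2Space G] [BorelSpace G] [μ.IsMulLeftInvariant]

theorem encard_inter_mul_measure_inv_le {E : Set G} (hE : IsCompact E) {N : ℝ≥0∞}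
    (hN : ∀ x : G, ((Λ ∩ x • E).encard : ℝ≥0∞) ≤ N) (S : Set G) :
    ((Λ ∩ S).encard : ℝ≥0∞) * μ E⁻¹ ≤ N * μ (S * E⁻¹) := by
  set Y := toMeasurable μ (S * E⁻¹)
  have hmeasure (l : ↥(Λ ∩ S)) : μ E⁻¹ = μ.restrict Y (((1 : G) * l) • E⁻¹) := by
    rw [one_mul, Measure.restrict_apply (hE.inv.smul l.1).measurableSet, Set.inter_eq_left.2,
      measure_smul]
    exact (Set.smul_set_subset_smul l.2.2).trans (subset_toMeasurable _ _)
  calc ((Λ ∩ S).encard : ℝ≥0∞) * μ E⁻¹ = ∑' _ : ↥(Λ ∩ S), μ E⁻¹ := (ENNReal.tsum_set_const _ _).symm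
    _ = ∑' l : ↥(Λ ∩ S), μ.restrict Y (((1 : G) * l) • E⁻¹) := tsum_congr hmeasure
    _ ≤ N * μ.restrict Y Set.univ :=
        tsum_measure_smul_inv_le _ hE.measurableSet
          (fun x => le_trans (by gcongr; exact Set.inter_subset_left) (hN x)) 1
    _ = N * μ (S * E⁻¹) := by rw [Measure.restrict_apply_univ, measure_toMeasurable]

namespace IsRelativelySeparated

variable [IsFiniteMeasureOnCompacts μ] [μ.IsInvInvariant]

theorem exists_encard_le (hΛ : IsRelativelySeparated μ Λ) :
    ∃ C, IsCompact C ∧ 1 ∈ C ∧ ∃ M : ℝ≥0∞, M ≠ ∞ ∧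
      ∀ S : Set G, ((Λ ∩ S).encard : ℝ≥0∞) ≤ M * μ (S * C) := by
  obtain ⟨E, hE, hE0, N, hN, hb⟩ := hΛ
  rw [← Measure.measure_inv] at hE0
  refine ⟨insert 1 E⁻¹, hE.inv.insert 1, Set.mem_insert 1 _, N / μ E⁻¹,
    ENNReal.div_ne_top hN hE0, fun S => ?_⟩
  rw [← ENNReal.mul_div_right_comm, ENNReal.le_div_iff_mul_le (Or.inl hE0)
    (Or.inl hE.inv.measure_lt_top.ne)]
  exact (encard_inter_mul_measure_inv_le hE hb S).trans
    (by gcongr; exact Set.subset_insert 1 E⁻¹)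

theorem exists_encard_inter_smul_le (hΛ : IsRelativelySeparated μ Λ) {S : Set G}
    (hS : IsCompact S) : ∃ N : ℝ≥0∞, N ≠ ∞ ∧ ∀ x : G, ((Λ ∩ x • S).encard : ℝ≥0∞) ≤ N := by
  obtain ⟨C, hC, -, M, hM, hb⟩ := hΛ.exists_encard_le
  refine ⟨M * μ (S * C), ENNReal.mul_ne_top hM (hS.mul hC).measure_lt_top.ne, fun x => ?_⟩
  rw [← measure_smul μ x (S * C), ← smul_mul_assoc]
  exact hb (x • S)

theorem finite_inter (hΛ : IsRelativelySeparated μ Λ) {S : Set G} (hS : IsCompact S) :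
    (Λ ∩ S).Finite := by
  obtain ⟨N, hN, hb⟩ := hΛ.exists_encard_inter_smul_le hS
  refine Set.encard_ne_top_iff.1 fun htop => hN (top_unique ?_)
  simpa [htop] using hb 1

theorem countable [SigmaCompactSpace G] (hΛ : IsRelativelySeparated μ Λ) : Λ.Countable := by
  rw [← Set.inter_univ Λ, ← iUnion_compactCovering, Set.inter_iUnion]
  exact Set.countable_iUnion fun n => (hΛ.finite_inter (isCompact_compactCovering G n)).countable

end IsRelativelySeparated

end RelativelySeparated

section RelativelyDense

theorem measure_le_encard_mul_measure_inv {G : Type*} [Group G] [MeasurableSpace G]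
    {μ : Measure G} [μ.IsMulLeftInvariant] {Γ L Y : Set G}
    (hcount : (Γ ∩ (Y * L)).Countable) (hL : ∀ x : G, (Γ ∩ x • L).Nonempty) :
    μ Y ≤ (Γ ∩ (Y * L)).encard * μ L⁻¹ := by
  have hcover : Y ⊆ ⋃ l ∈ Γ ∩ (Y * L), l • L⁻¹ := by
    intro y hy
    obtain ⟨_, hlΓ, z, hz, rfl⟩ := hL y
    exact Set.mem_biUnion ⟨hlΓ, Set.mul_mem_mul hy hz⟩ ⟨z⁻¹, Set.inv_mem_inv.2 hz, by simp⟩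
  calc μ Y ≤ μ (⋃ l ∈ Γ ∩ (Y * L), l • L⁻¹) := measure_mono hcover
    _ ≤ ∑' l : ↥(Γ ∩ (Y * L)), μ (l.1 • L⁻¹) := measure_biUnion_le μ hcount _
    _ = (Γ ∩ (Y * L)).encard * μ L⁻¹ := by simp only [measure_smul, ENNReal.tsum_set_const]

variable {G : Type*} [Group G] [TopologicalSpace G] {Γ : Set G}

/-- `Γ` is relatively dense if it meets every translate of some compact set. -/
def IsRelativelyDense (Γ : Set G) : Prop :=
  ∃ L, IsCompact L ∧ ∀ x : G, (Γ ∩ x • L).Nonempty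

variable [MeasurableSpace G] {μ : Measure G}

theorem isRelativelyDense_of_lowerBeurlingDensity_pos {K : ℕ → Set G} (hK : ∀ n, IsCompact (K n))
    (hΓ : 0 < lowerBeurlingDensity μ K Γ) : IsRelativelyDense Γ := by
  obtain ⟨n, hn⟩ := (eventually_lt_of_lt_liminf hΓ).exists
  refine ⟨K n, hK n, fun x => Set.nonempty_iff_ne_empty.2 fun hx => ?_⟩
  simpa [hx] using hn.trans_le (iInf_le _ x)

theorem IsRelativelyDense.liminf_pos [IsTopologicalGroup G] [T2Space G] [BorelSpace G]
    [IsFiniteMeasureOnCompacts μ] [μ.IsMulLeftInvariant] [μ.IsInvInvariant]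
    (hΓ : IsRelativelyDense Γ) (hΓ' : IsRelativelySeparated μ Γ) {K : ℕ → Set G}
    (hK : IsStrongFolner μ K) :
    0 < liminf (fun n => ((Γ ∩ K n).encard : ℝ≥0∞) / μ (K n)) atTop := by
  obtain ⟨L, hL, hLΓ⟩ := hΓ
  obtain ⟨C, hC, -, M, hM, hMC⟩ := hΓ'.exists_encard_le
  refine lt_of_lt_of_le (ENNReal.inv_pos.2 (hL.inv.measure_lt_top (μ := μ)).ne)
    (hK.le_liminf_div ((hL.insert 1).mul hC) hM fun n => ?_)
  have hcount := (hΓ'.finite_inter ((hK.isCompact n).mul hL)).countable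
  calc (μ L⁻¹)⁻¹ * μ (K n) ≤ (Γ ∩ (K n * L)).encard := by
        rw [mul_comm, ← div_eq_mul_inv]
        exact ENNReal.div_le_of_le_mul (measure_le_encard_mul_measure_inv hcount hLΓ)
    _ ≤ (Γ ∩ (K n ∪ boundaryLayer (K n) (insert 1 L))).encard := by
        gcongr
        exact (Set.mul_subset_mul_left (Set.subset_insert 1 L)).trans
          (mul_subset_union_boundaryLayer (Set.mem_insert 1 L))
    _ ≤ (Γ ∩ K n).encard + (Γ ∩ boundaryLayer (K n) (insert 1 L)).encard :=
        encard_inter_union_le _ _ _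
    _ ≤ (Γ ∩ K n).encard + M * μ (boundaryLayer (K n) (insert 1 L * C)) := by
        gcongr
        exact (hMC _).trans (by gcongr; exact boundaryLayer_mul_subset)

end RelativelyDense

theorem memLp_two_iff_lintegral_enorm_sq {α E : Type*} {m : MeasurableSpace α} {μ : Measure α}
    [TopologicalSpace E] [ContinuousENorm E] {f : α → E} (hf : AEStronglyMeasurable f μ) :
    MemLp f 2 μ ↔ ∫⁻ x, ‖f x‖ₑ ^ 2 ∂μ ≠ ∞ := by
  rw [MemLp, and_iff_right hf,
    eLpNorm_lt_top_iff_lintegral_rpow_enorm_lt_top two_ne_zero ENNReal.ofNat_ne_top,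
    lt_top_iff_ne_top]
  simp only [ENNReal.toReal_ofNat, ENNReal.rpow_ofNat]

theorem measurePreserving_inv_mul {G : Type*} [Group G] [MeasurableSpace G] [MeasurableMul G]
    [MeasurableInv G] (μ : Measure G) [μ.IsMulLeftInvariant] [μ.IsInvInvariant] (y : G) :
    MeasurePreserving (fun x => x⁻¹ * y) μ μ := by
  convert (Measure.measurePreserving_inv μ).comp (measurePreserving_mul_left μ y⁻¹) using 2 with x
  simp only [Function.comp_apply, mul_inv_rev, inv_inv]

section LocalMaximalFunction

variable {G : Type*} [Group G] [TopologicalSpace G] [IsTopologicalGroup G]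
  [SecondCountableTopology G] [MeasurableSpace G] [BorelSpace G] {μ : Measure G} {Q : Set G}

section

variable [SFinite μ] [μ.IsMulLeftInvariant] {F : G → ℂ}

theorem ae_ae_mem_smul_inv_enorm_le_leftLocalMax (hQ : MeasurableSet Q) (hF : Measurable F)
    (hFQ : AEMeasurable (leftLocalMax μ Q F) μ) :
    ∀ᵐ y ∂μ, ∀ᵐ w ∂μ, w ∈ y • Q⁻¹ → ‖F y‖ₑ ≤ leftLocalMax μ Q F w := by
  obtain ⟨m, hm, hmF⟩ := hFQ
  have hdom : ∀ᵐ w ∂μ, ∀ᵐ y ∂μ, w⁻¹ * y ∈ Q → ‖F y‖ₑ ≤ m w := by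
    filter_upwards [hmF] with w hw
    have hess : ∀ᵐ z ∂μ, z ∈ Q → ‖F (w * z)‖ₑ ≤ leftLocalMax μ Q F w :=
      (ae_restrict_iff' hQ).1 (ENNReal.ae_le_essSup fun z => ‖F (w * z)‖ₑ)
    filter_upwards [(measurePreserving_mul_left μ w⁻¹).quasiMeasurePreserving.ae hess] with y hy
    simpa only [mul_inv_cancel_left, hw] using hy
  have hmeas : MeasurableSet {p : G × G | p.1⁻¹ * p.2 ∈ Q → ‖F p.2‖ₑ ≤ m p.1} :=
    ((measurable_fst.inv.mul measurable_snd) hQ).imp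
      (measurableSet_le (hF.comp measurable_snd).enorm (hm.comp measurable_fst))
  filter_upwards [(Measure.ae_ae_comm hmeas).1 hdom] with y hy
  filter_upwards [hy, hmF] with w hw hwm hwQ
  rw [hwm]
  exact hw (by simpa [Set.mem_smul_set_iff_inv_smul_mem] using hwQ)

theorem ae_measure_mul_enorm_sq_le_setLIntegral [μ.IsInvInvariant] (hQ : MeasurableSet Q)
    (hF : Measurable F) (hFQ : AEMeasurable (leftLocalMax μ Q F) μ) :
    ∀ᵐ y ∂μ, μ Q * ‖F y‖ₑ ^ 2 ≤ ∫⁻ w in y • Q⁻¹, leftLocalMax μ Q F w ^ 2 ∂μ := by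
  filter_upwards [ae_ae_mem_smul_inv_enorm_le_leftLocalMax hQ hF hFQ] with y hy
  calc μ Q * ‖F y‖ₑ ^ 2 = ∫⁻ _ in y • Q⁻¹, ‖F y‖ₑ ^ 2 ∂μ := by
        rw [setLIntegral_const, measure_smul, Measure.measure_inv, mul_comm]
    _ ≤ ∫⁻ w in y • Q⁻¹, leftLocalMax μ Q F w ^ 2 ∂μ :=
        setLIntegral_mono_ae' (hQ.inv.const_smul y)
          (hy.mono fun w hw hwQ => pow_le_pow_left' (hw hwQ) 2)

end

variable [LocallyCompactSpace G] [T2Space G]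

theorem exists_isCompact_setLIntegral_compl_le {f : G → ℝ≥0∞} (hf : ∫⁻ x, f x ∂μ ≠ ∞)
    {ε : ℝ≥0∞} (hε : ε ≠ 0) : ∃ C : Set G, IsCompact C ∧ ∫⁻ x in Cᶜ, f x ∂μ ≤ ε := by
  have : IsFiniteMeasure (μ.withDensity f) := isFiniteMeasure_withDensity hf
  obtain ⟨C, -, hC, hCε⟩ := MeasurableSet.univ.exists_isCompact_sdiff_lt
    (measure_ne_top (μ.withDensity f) Set.univ) hε
  rw [← Set.compl_eq_univ_sdiff, withDensity_apply _ hC.measurableSet.compl] at hCε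
  exact ⟨C, hC, hCε.le⟩

variable [IsFiniteMeasureOnCompacts μ] [μ.IsMulLeftInvariant] [μ.IsInvInvariant] {F : G → ℂ}

theorem IsRelativelySeparated.exists_isCompact_tsum_indicator_compl_le {Λ : Set G}
    (hΛ : IsRelativelySeparated μ Λ) (hQ : IsCompact Q) (hQ₀ : μ Q ≠ 0) (hF : Measurable F)
    (hFQ : MemLp (leftLocalMax μ Q F) 2 μ) {ε : ℝ≥0∞} (hε : ε ≠ 0) :
    ∃ C : Set G, IsCompact C ∧
      ∀ᵐ x ∂μ, ∑' l : Λ, Cᶜ.indicator (fun y => ‖F y‖ₑ ^ 2) (x⁻¹ * l) ≤ ε := by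
  have := hΛ.countable.to_subtype
  obtain ⟨N, hN, hΛN⟩ := hΛ.exists_encard_inter_smul_le hQ
  obtain ⟨C, hC, hCε⟩ := exists_isCompact_setLIntegral_compl_le
    ((memLp_two_iff_lintegral_enorm_sq hFQ.1).1 hFQ) (ε := ε * μ Q / (N + 1))
    (ENNReal.div_ne_zero.2 ⟨mul_ne_zero hε hQ₀, by finiteness⟩)
  refine ⟨C * Q, hC.mul hQ, ?_⟩
  have hsample : ∀ᵐ x ∂μ, ∀ l : Λ, μ Q * ‖F (x⁻¹ * l)‖ₑ ^ 2 ≤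
      ∫⁻ w in (x⁻¹ * l) • Q⁻¹, leftLocalMax μ Q F w ^ 2 ∂μ :=
    ae_all_iff.2 fun l => (measurePreserving_inv_mul μ (l : G)).quasiMeasurePreserving.ae
      (ae_measure_mul_enorm_sq_le_setLIntegral hQ.measurableSet hF hFQ.1.aemeasurable)
  filter_upwards [hsample] with x hx
  set ν := μ.withDensity fun w => leftLocalMax μ Q F w ^ 2
  have hterm (l : Λ) : μ Q * (C * Q)ᶜ.indicator (fun y => ‖F y‖ₑ ^ 2) (x⁻¹ * l) ≤
      ν.restrict Cᶜ ((x⁻¹ * l) • Q⁻¹) := by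
    have hQl : MeasurableSet ((x⁻¹ * (l : G)) • Q⁻¹) := hQ.measurableSet.inv.const_smul _
    by_cases hl : x⁻¹ * (l : G) ∈ C * Q
    · rw [Set.indicator_of_notMem (Set.notMem_compl_iff.2 hl), mul_zero]
      exact zero_le
    · have hsub : (x⁻¹ * (l : G)) • Q⁻¹ ⊆ Cᶜ := by
        rintro _ ⟨q, hq, rfl⟩ hmem
        exact hl ⟨_, hmem, q⁻¹, hq, mul_inv_cancel_right _ _⟩
      rw [Set.indicator_of_mem (Set.mem_compl hl), Measure.restrict_eq_self _ hsub,
        withDensity_apply _ hQl]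
      exact hx l
  refine (ENNReal.mul_le_mul_iff_right hQ₀ hQ.measure_lt_top.ne).1 ?_
  calc μ Q * ∑' l : Λ, (C * Q)ᶜ.indicator (fun y => ‖F y‖ₑ ^ 2) (x⁻¹ * l)
      ≤ ∑' l : Λ, ν.restrict Cᶜ ((x⁻¹ * l) • Q⁻¹) := by
        rw [← ENNReal.tsum_mul_left]
        exact ENNReal.tsum_le_tsum hterm
    _ ≤ N * ν.restrict Cᶜ Set.univ :=
        tsum_measure_smul_inv_le _ hQ.measurableSet hΛN x⁻¹
    _ ≤ (N + 1) * (ε * μ Q / (N + 1)) := by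
        rw [Measure.restrict_apply_univ, withDensity_apply _ hC.measurableSet.compl]
        exact mul_le_mul' le_self_add hCε
    _ = μ Q * ε := by
        rw [ENNReal.mul_div_cancel (by simp) (by finiteness), mul_comm]

end LocalMaximalFunction

section SchurBound

variable {ι α : Type*} [MeasurableSpace α] {μ : Measure α} {κ κ' : ι → α → ℝ≥0∞} {s t : ℝ≥0∞}

/-- The hypothesis of Schur's test for a kernel `κ`, with counting measure on `ι`: the sums over `ι`
and the integrals over `α` are bounded by `s`. -/
structure IsSchurBounded (μ : Measure α) (κ : ι → α → ℝ≥0∞) (s : ℝ≥0∞) : Prop where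
  tsum_le : ∀ᵐ x ∂μ, ∑' i, κ i x ≤ s
  lintegral_le : ∀ i, ∫⁻ x, κ i x ∂μ ≤ s

theorem IsSchurBounded.mono (h : IsSchurBounded μ κ s) (hκ : ∀ i x, κ' i x ≤ κ i x) (hs : s ≤ t) :
    IsSchurBounded μ κ' t where
  tsum_le := h.tsum_le.mono fun x hx =>
    (ENNReal.tsum_le_tsum fun i => hκ i x).trans (hx.trans hs)
  lintegral_le i := (lintegral_mono (hκ i)).trans ((h.lintegral_le i).trans hs)

theorem lintegral_mul_le_of_lintegral_sq_le {f g : α → ℝ≥0∞} (hf : AEMeasurable f μ)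
    (hg : AEMeasurable g μ) (hs : ∫⁻ x, f x ^ 2 ∂μ ≤ s ^ 2) (ht : ∫⁻ x, g x ^ 2 ∂μ ≤ t ^ 2) :
    ∫⁻ x, f x * g x ∂μ ≤ s * t := by
  have hroot {a b : ℝ≥0∞} (h : a ≤ b ^ 2) : a ^ (1 / 2 : ℝ) ≤ b := by
    rwa [one_div, ENNReal.rpow_inv_le_iff two_pos, ENNReal.rpow_ofNat]
  have hholder := ENNReal.lintegral_mul_le_Lp_mul_Lq μ .two_two hf hg
  simp only [ENNReal.rpow_ofNat] at hholder
  exact hholder.trans (mul_le_mul' (hroot hs) (hroot ht))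

theorem tsum_mul_le_of_tsum_sq_le {f g : ι → ℝ≥0∞} (hs : ∑' i, f i ^ 2 ≤ s ^ 2)
    (ht : ∑' i, g i ^ 2 ≤ t ^ 2) : ∑' i, f i * g i ≤ s * t := by
  let _ : MeasurableSpace ι := ⊤
  rw [← lintegral_count] at hs ht ⊢
  exact lintegral_mul_le_of_lintegral_sq_le measurable_from_top.aemeasurable
    measurable_from_top.aemeasurable hs ht

theorem IsSchurBounded.mul (hκ : IsSchurBounded μ (fun i x => κ i x ^ 2) (s ^ 2))
    (hκ' : IsSchurBounded μ (fun i x => κ' i x ^ 2) (t ^ 2)) (hm : ∀ i, AEMeasurable (κ i) μ)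
    (hm' : ∀ i, AEMeasurable (κ' i) μ) : IsSchurBounded μ (fun i x => κ i x * κ' i x) (s * t) where
  tsum_le := by
    filter_upwards [hκ.tsum_le, hκ'.tsum_le] with x hx hx'
    exact tsum_mul_le_of_tsum_sq_le hx hx'
  lintegral_le i := lintegral_mul_le_of_lintegral_sq_le (hm i) (hm' i)
    (hκ.lintegral_le i) (hκ'.lintegral_le i)

end SchurBound

section OffDiagonal

variable {G : Type*} [Group G] {Λ : Set G}

/-- The part of a kernel `κ` on `Λ × G` that lives off the `C`-diagonal `{(l, x) | l ∈ x C}`. -/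
noncomputable def offDiagonal (C : Set G) (κ : Λ → G → ℝ≥0∞) (l : Λ) (x : G) : ℝ≥0∞ :=
  Cᶜ.indicator (fun _ => κ l x) (x⁻¹ * l)

theorem offDiagonal_of_notMem {C : Set G} {κ : Λ → G → ℝ≥0∞} {l : Λ} {x : G}
    (h : x⁻¹ * (l : G) ∉ C) : offDiagonal C κ l x = κ l x :=
  Set.indicator_of_mem (Set.mem_compl h) _

theorem offDiagonal_anti {C D : Set G} (h : C ⊆ D) (κ : Λ → G → ℝ≥0∞) (l : Λ) (x : G) :
    offDiagonal D κ l x ≤ offDiagonal C κ l x :=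
  Set.indicator_le_indicator_of_subset (Set.compl_subset_compl.2 h) (fun _ => zero_le) _

theorem offDiagonal_sq (C : Set G) (κ : Λ → G → ℝ≥0∞) (l : Λ) (x : G) :
    offDiagonal C κ l x ^ 2 = offDiagonal C (fun l x => κ l x ^ 2) l x := by
  by_cases h : x⁻¹ * (l : G) ∈ C <;> simp [offDiagonal, h]

theorem offDiagonal_mul_right (C : Set G) (κ κ' : Λ → G → ℝ≥0∞) (l : Λ) (x : G) :
    offDiagonal C (fun l x => κ l x * κ' l x) l x = offDiagonal C κ l x * κ' l x := by
  by_cases h : x⁻¹ * (l : G) ∈ C <;> simp [offDiagonal, h]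

variable [MeasurableSpace G] {μ : Measure G} {K C : Set G}

variable {E : Type*} [NormedAddCommGroup E] [NormedSpace ℝ E] {Φ : Λ → G → E} {β η : ℝ≥0∞}

theorem enorm_setIntegral_le_of_isSchurBounded (hΦ : ∀ l, Integrable (Φ l) μ)
    (hβ : IsSchurBounded μ (fun l x => ‖Φ l x‖ₑ) β)
    (hη : IsSchurBounded μ (offDiagonal C fun l x => ‖Φ l x‖ₑ) η) (hC : 1 ∈ C)
    (hK : MeasurableSet K) (l : Λ) :
    ‖∫ x in K, Φ l x ∂μ‖ₑ ≤ K.indicator (fun _ => ‖∫ x, Φ l x ∂μ‖ₑ) l + η * K.indicator 1 (l : G)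
      + β * (boundaryLayer K C).indicator 1 (l : G)
      + ∫⁻ x in K, offDiagonal C (fun l x => ‖Φ l x‖ₑ) l x ∂μ := by
  have hsub : K ⊆ K * C := Set.subset_mul_left K hC
  have hsub' : Kᶜ ⊆ Kᶜ * C := Set.subset_mul_left Kᶜ hC
  by_cases hlb : (l : G) ∈ boundaryLayer K C
  · calc ‖∫ x in K, Φ l x ∂μ‖ₑ ≤ ∫⁻ x in K, ‖Φ l x‖ₑ ∂μ := enorm_integral_le_lintegral_enorm _
      _ ≤ β := (setLIntegral_le_lintegral _ _).trans (hβ.lintegral_le l)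
      _ ≤ _ := by
        rw [Set.indicator_of_mem hlb, Pi.one_apply, mul_one]
        exact le_add_right le_add_self
  have hoff {Y : Set G} (hY : MeasurableSet Y) (hlY : (l : G) ∉ Y * C) :
      ‖∫ x in Y, Φ l x ∂μ‖ₑ ≤ ∫⁻ x in Y, offDiagonal C (fun l x => ‖Φ l x‖ₑ) l x ∂μ := by
    refine (enorm_integral_le_lintegral_enorm _).trans (setLIntegral_mono' hY fun x hx => ?_)
    rw [offDiagonal_of_notMem fun hxl => hlY ⟨x, hx, _, hxl, mul_inv_cancel_left _ _⟩]
  -- Off the boundary layer, `l ∈ K` forces `l ∉ Kᶜ C`, so the integral over `K` differs from the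
  -- full one by an integral that only sees the off-diagonal part.
  by_cases hlK : (l : G) ∈ K
  · have hlC : (l : G) ∉ Kᶜ * C := fun h => hlb ⟨hsub hlK, h⟩
    have hcompl : ‖∫ x in Kᶜ, Φ l x ∂μ‖ₑ ≤ η :=
      (hoff hK.compl hlC).trans ((setLIntegral_le_lintegral _ _).trans (hη.lintegral_le l))
    rw [eq_sub_of_add_eq (integral_add_compl hK (hΦ l)), Set.indicator_of_mem hlK,
      Set.indicator_of_mem hlK, Pi.one_apply, mul_one, add_assoc]
    exact (enorm_sub_le.trans (by gcongr)).trans le_self_add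
  · have hlC : (l : G) ∉ K * C := fun h => hlb ⟨h, hsub' hlK⟩
    exact (hoff hK hlC).trans le_add_self

variable [MeasurableMul G] [MeasurableInv G]

theorem aemeasurable_offDiagonal (hC : MeasurableSet C) {κ : Λ → G → ℝ≥0∞} {l : Λ}
    (hκ : AEMeasurable (κ l) μ) : AEMeasurable (offDiagonal C κ l) μ :=
  hκ.indicator ((measurable_inv.mul_const (l : G)) hC.compl)

theorem exists_isSchurBounded_offDiagonal_mul [TopologicalSpace G] [T2Space G]
    [OpensMeasurableSpace G] {κ κ' : Λ → G → ℝ≥0∞} {b : ℝ≥0∞}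
    (hκ : ∀ ε : ℝ≥0∞, ε ≠ 0 →
      ∃ C, IsCompact C ∧ IsSchurBounded μ (offDiagonal C fun l x => κ l x ^ 2) ε)
    (hκ' : IsSchurBounded μ (fun l x => κ' l x ^ 2) (b ^ 2)) (hb : b ≠ 0) (hb' : b ≠ ∞)
    (hm : ∀ l, AEMeasurable (κ l) μ) (hm' : ∀ l, AEMeasurable (κ' l) μ) (hη : η ≠ 0) :
    ∃ C, IsCompact C ∧ IsSchurBounded μ (offDiagonal C fun l x => κ l x * κ' l x) η := by
  obtain ⟨C, hC, hCη⟩ := hκ ((η / b) ^ 2) (pow_ne_zero 2 (ENNReal.div_ne_zero.2 ⟨hη, hb'⟩))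
  have hmul := IsSchurBounded.mul (κ := offDiagonal C κ) (by simpa only [offDiagonal_sq]) hκ'
    (fun l => aemeasurable_offDiagonal hC.measurableSet (hm l)) hm'
  rw [ENNReal.div_mul_cancel hb hb'] at hmul
  exact ⟨C, hC, by simpa only [← offDiagonal_mul_right] using hmul⟩

variable [CompleteSpace E]

theorem enorm_mul_measure_le_of_isSchurBounded (hΛ : Λ.Countable) (hΦ : ∀ l, Integrable (Φ l) μ)
    {r : E} (hr : ∀ᵐ x ∂μ, HasSum (fun l => Φ l x) r)
    (hβ : IsSchurBounded μ (fun l x => ‖Φ l x‖ₑ) β) (hβ' : β ≠ ∞)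
    (hη : IsSchurBounded μ (offDiagonal C fun l x => ‖Φ l x‖ₑ) η) (hC : 1 ∈ C)
    (hCm : MeasurableSet C) (hK : MeasurableSet K) (hKμ : μ K ≠ ∞) :
    ‖r‖ₑ * μ K ≤ ∑' l : Λ, K.indicator (fun _ => ‖∫ x, Φ l x ∂μ‖ₑ) (l : G) +
      η * (Λ ∩ K).encard + β * (Λ ∩ boundaryLayer K C).encard + η * μ K := by
  have := hΛ.to_subtype
  have hswap : ∑' l, ∫⁻ x in K, ‖Φ l x‖ₑ ∂μ ≤ β * μ K := by
    rw [← lintegral_tsum fun l => (hΦ l).aestronglyMeasurable.enorm.restrict, ← setLIntegral_const]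
    exact lintegral_mono_ae (ae_restrict_of_ae hβ.tsum_le)
  have htail : ∑' l, ∫⁻ x in K, offDiagonal C (fun l x => ‖Φ l x‖ₑ) l x ∂μ ≤ η * μ K := by
    rw [← lintegral_tsum fun l => (aemeasurable_offDiagonal hCm
      (hΦ l).aestronglyMeasurable.enorm).restrict, ← setLIntegral_const]
    exact lintegral_mono_ae (ae_restrict_of_ae hη.tsum_le)
  calc ‖r‖ₑ * μ K = ‖∫ _ in K, r ∂μ‖ₑ := by
        rw [setIntegral_const, enorm_smul, mul_comm, Real.enorm_of_nonneg measureReal_nonneg,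
          ofReal_measureReal hKμ]
    _ = ‖∑' l, ∫ x in K, Φ l x ∂μ‖ₑ := by
        rw [← integral_tsum (fun l => (hΦ l).aestronglyMeasurable.restrict)
          (ne_top_of_le_ne_top (by finiteness) hswap)]
        congr 1
        exact integral_congr_ae (ae_restrict_of_ae (hr.mono fun x hx => hx.tsum_eq.symm))
    _ ≤ ∑' l, ‖∫ x in K, Φ l x ∂μ‖ₑ := enorm_tsum_le_tsum_enorm
    _ ≤ _ := ENNReal.tsum_le_tsum fun l =>
        enorm_setIntegral_le_of_isSchurBounded hΦ hβ hη hC hK l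
    _ ≤ _ := by
        rw [ENNReal.tsum_add, ENNReal.tsum_add, ENNReal.tsum_add, ENNReal.tsum_mul_left,
          ENNReal.tsum_mul_left, tsum_indicator_one_eq_encard, tsum_indicator_one_eq_encard]
        gcongr

end OffDiagonal

theorem IsStrongFolner.enorm_le_liminf_of_isSchurBounded {G : Type*} [Group G] [TopologicalSpace G]
    [IsTopologicalGroup G] [T2Space G] [SigmaCompactSpace G] [MeasurableSpace G] [BorelSpace G]
    {μ : Measure G} [IsFiniteMeasureOnCompacts μ] [μ.IsMulLeftInvariant] [μ.IsInvInvariant]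
    {E : Type*} [NormedAddCommGroup E] [NormedSpace ℝ E] [CompleteSpace E] {K : ℕ → Set G}
    (hK : IsStrongFolner μ K) {Λ : Set G} (hΛ : IsRelativelySeparated μ Λ) {Φ : Λ → G → E}
    (hΦ : ∀ l, Integrable (Φ l) μ) {r : E} (hr : ∀ᵐ x ∂μ, HasSum (fun l => Φ l x) r) {β : ℝ≥0∞}
    (hβ : IsSchurBounded μ (fun l x => ‖Φ l x‖ₑ) β) (hβ' : β ≠ ∞)
    (hoff : ∀ η : ℝ≥0∞, η ≠ 0 →
      ∃ C, IsCompact C ∧ IsSchurBounded μ (offDiagonal C fun l x => ‖Φ l x‖ₑ) η) :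
    ‖r‖ₑ ≤ liminf (fun n => (∑' l : Λ, (K n).indicator (fun _ => ‖∫ x, Φ l x ∂μ‖ₑ) (l : G)) /
      μ (K n)) atTop := by
  obtain ⟨C₀, hC₀, h1C₀, M, hM, hΛM⟩ := hΛ.exists_encard_le
  refine ENNReal.le_of_forall_pos_le_add fun δ hδ _ => tsub_le_iff_right.1 ?_
  set η : ℝ≥0∞ := δ / (M + 1) with hη_def
  have hη : η * M + η = δ := by
    rw [← mul_add_one, hη_def, ENNReal.div_mul_cancel (by simp) (by finiteness)]
  have hη_top : η ≠ ∞ := ENNReal.div_ne_top ENNReal.coe_ne_top (by simp)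
  obtain ⟨C, hC, hCη⟩ :=
    hoff η (ENNReal.div_ne_zero.2 ⟨ENNReal.coe_ne_zero.2 hδ.ne', by finiteness⟩)
  set D := insert 1 C
  have hD : IsCompact D := hC.insert 1
  have h1D : 1 ∈ D := Set.mem_insert 1 C
  refine hK.le_liminf_div (hD.mul hC₀) (R := η * M + β * M) (by finiteness) fun n => ?_
  have hcount : (Λ ∩ K n).encard ≤ M * (μ (K n) + μ (boundaryLayer (K n) (D * C₀))) := by
    refine (hΛM _).trans (mul_le_mul_right ((measure_mono ?_).trans (measure_union_le _ _)) M)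
    exact (Set.mul_subset_mul_left (Set.subset_mul_right C₀ h1D)).trans
      (mul_subset_union_boundaryLayer ⟨1, h1D, 1, h1C₀, mul_one 1⟩)
  have hbdry : (Λ ∩ boundaryLayer (K n) D).encard ≤ M * μ (boundaryLayer (K n) (D * C₀)) :=
    (hΛM _).trans (mul_le_mul_right (measure_mono boundaryLayer_mul_subset) M)
  have hmain := enorm_mul_measure_le_of_isSchurBounded hΛ.countable hΦ hr hβ hβ'
    (hCη.mono (offDiagonal_anti (Set.subset_insert 1 C) _) le_rfl) h1D hD.measurableSet
    (hK.isCompact n).measurableSet (hK.isCompact n).measure_lt_top.ne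
  rw [ENNReal.sub_mul fun _ _ => (hK.isCompact n).measure_lt_top.ne, tsub_le_iff_right]
  calc ‖r‖ₑ * μ (K n) ≤ _ := hmain
    _ ≤ ∑' l : Λ, (K n).indicator (fun _ => ‖∫ x, Φ l x ∂μ‖ₑ) (l : G) +
        η * (M * (μ (K n) + μ (boundaryLayer (K n) (D * C₀)))) +
        β * (M * μ (boundaryLayer (K n) (D * C₀))) + η * μ (K n) := by gcongr
    _ = _ := by rw [← hη]; ring

theorem IsRelativelySeparated.exists_isSchurBounded_offDiagonal {G : Type*} [Group G]
    [TopologicalSpace G] [IsTopologicalGroup G] [T2Space G] [LocallyCompactSpace G]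
    [SecondCountableTopology G] [MeasurableSpace G] [BorelSpace G] {μ : Measure G}
    [IsFiniteMeasureOnCompacts μ] [μ.IsMulLeftInvariant] [μ.IsInvInvariant] {Q Λ : Set G}
    (hΛ : IsRelativelySeparated μ Λ) (hQ : IsCompact Q) (hQ₀ : μ Q ≠ 0) {F : G → ℂ}
    (hF : Measurable F) (hF₂ : MemLp F 2 μ) (hFQ : MemLp (leftLocalMax μ Q F) 2 μ) {ε : ℝ≥0∞}
    (hε : ε ≠ 0) : ∃ C : Set G, IsCompact C ∧
      IsSchurBounded μ (offDiagonal C fun (l : Λ) x => ‖F (x⁻¹ * l)‖ₑ ^ 2) ε := by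
  obtain ⟨C₁, hC₁, hsum⟩ := hΛ.exists_isCompact_tsum_indicator_compl_le hQ hQ₀ hF hFQ hε
  obtain ⟨C₂, hC₂, hint⟩ := exists_isCompact_setLIntegral_compl_le
    ((memLp_two_iff_lintegral_enorm_sq hF₂.1).1 hF₂) hε
  refine ⟨C₁ ∪ C₂, hC₁.union hC₂, ⟨hsum.mono fun x hx => ?_, fun l => ?_⟩⟩
  · exact (ENNReal.tsum_le_tsum fun l =>
      offDiagonal_anti Set.subset_union_left (fun (l : Λ) x => ‖F (x⁻¹ * l)‖ₑ ^ 2) l x).trans hx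
  calc ∫⁻ x, offDiagonal (C₁ ∪ C₂) (fun (l : Λ) x => ‖F (x⁻¹ * l)‖ₑ ^ 2) l x ∂μ
      ≤ ∫⁻ x, C₂ᶜ.indicator (fun y => ‖F y‖ₑ ^ 2) (x⁻¹ * l) ∂μ :=
        lintegral_mono fun x => offDiagonal_anti Set.subset_union_right _ l x
    _ = ∫⁻ y, C₂ᶜ.indicator (fun y => ‖F y‖ₑ ^ 2) y ∂μ :=
        (measurePreserving_inv_mul μ (l : G)).lintegral_comp
          ((hF.enorm.pow_const 2).indicator hC₂.measurableSet.compl)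
    _ ≤ ε := by rwa [lintegral_indicator hC₂.measurableSet.compl]

theorem le_liminf_of_mul_le_liminf_mul {α : Type*} {f : Filter α} [f.NeBot] {a c : ℝ≥0∞}
    {u : α → ℝ≥0∞} (hc : c ≠ 0) (hc' : c ≠ ∞) (h : c * a ≤ liminf (fun n => c * u n) f) :
    a ≤ liminf u f :=
  calc a = c⁻¹ * (c * a) := (ENNReal.inv_mul_cancel_left hc hc').symm
    _ ≤ liminf (fun _ => c⁻¹) f * liminf (fun n => c * u n) f := by
        rw [liminf_const]
        gcongr
    _ ≤ liminf (fun n => c⁻¹ * (c * u n)) f := ENNReal.le_liminf_mul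
    _ = liminf u f := by simp only [ENNReal.inv_mul_cancel_left hc hc']

theorem enorm_complex_ofReal (r : ℝ) : ‖(r : ℂ)‖ₑ = ‖r‖ₑ := by
  rw [← ofReal_norm, Complex.norm_real, ofReal_norm]

theorem enorm_inner_self {H : Type*} [NormedAddCommGroup H] [InnerProductSpace ℂ H] (f : H) :
    ‖inner ℂ f f‖ₑ = ‖f‖ₑ ^ 2 := by
  rw [← ofReal_norm, ← inner_self_re_eq_norm, inner_self_eq_norm_sq,
    ENNReal.ofReal_pow (norm_nonneg f), ofReal_norm]

namespace ProjectiveRep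

section

variable {G H : Type*} [Group G] [MeasurableSpace G] [NormedAddCommGroup H] [InnerProductSpace ℂ H]
  (π : ProjectiveRep G H)

theorem norm_inner_op_op (x y : G) (f g : H) :
    ‖inner ℂ (π.op x f) (π.op y g)‖ = ‖π.coeff g f (x⁻¹ * y)‖ := by
  have hy := π.op_mul x (x⁻¹ * y) g
  rw [mul_inv_cancel_left] at hy
  rw [hy, inner_smul_right, LinearIsometryEquiv.inner_map_map, norm_mul, Circle.norm_coe, one_mul,
    norm_inner_symm, coeff]

theorem measurable_coeff (g f : H) : Measurable (π.coeff g f) :=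
  ((π.stronglyMeasurable g).inner stronglyMeasurable_const).measurable

variable {π} {μ : Measure G} {d : ℝ}

theorem IsFormalDegree.lintegral_enorm_coeff_sq (hd : π.IsFormalDegree μ d) (g f : H) :
    ∫⁻ x, ‖π.coeff g f x‖ₑ ^ 2 ∂μ = ENNReal.ofReal d⁻¹ * ‖f‖ₑ ^ 2 * ‖g‖ₑ ^ 2 := by
  obtain ⟨hint, hval⟩ := hd.2 f f g g
  have hsq (x : G) : inner ℂ (π.op x g) f * inner ℂ f (π.op x g) = (‖π.coeff g f x‖ ^ 2 : ℝ) := by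
    rw [← inner_conj_symm f, Complex.mul_conj', Complex.ofReal_pow, coeff]
  simp only [hsq] at hint hval
  rw [integral_complex_ofReal, inner_self_eq_norm_sq_to_K, inner_self_eq_norm_sq_to_K] at hval
  have hval' : ∫ x, ‖π.coeff g f x‖ ^ 2 ∂μ = d⁻¹ * ‖f‖ ^ 2 * ‖g‖ ^ 2 := by
    refine Complex.ofReal_injective (hval.trans ?_)
    simp
  have henorm (x : ℂ) : ‖x‖ₑ ^ 2 = ENNReal.ofReal (‖x‖ ^ 2) := by
    rw [← ofReal_norm, ENNReal.ofReal_pow (norm_nonneg x)]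
  simp only [henorm]
  rw [← ofReal_integral_eq_lintegral_ofReal (by exact hint.re)
    (Eventually.of_forall fun x => sq_nonneg _), hval',
    ENNReal.ofReal_mul (mul_nonneg (inv_nonneg.2 hd.1.le) (sq_nonneg _)),
    ENNReal.ofReal_mul (inv_nonneg.2 hd.1.le), ENNReal.ofReal_pow (norm_nonneg _),
    ENNReal.ofReal_pow (norm_nonneg _), ofReal_norm, ofReal_norm]

theorem IsFormalDegree.enorm_integral_inner_mul_inner (hd : π.IsFormalDegree μ d) (f f' g : H) :
    ‖∫ x, inner ℂ (π.op x g) f * inner ℂ f' (π.op x g) ∂μ‖ₑ =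
      ENNReal.ofReal d⁻¹ * ‖g‖ₑ ^ 2 * ‖inner ℂ f' f‖ₑ := by
  rw [(hd.2 f f' g g).2, enorm_mul, enorm_mul, RCLike.enorm_conj, ← Complex.ofReal_inv,
    enorm_complex_ofReal, Real.enorm_of_nonneg (inv_nonneg.2 hd.1.le), enorm_inner_self,
    mul_right_comm]

theorem IsFormalDegree.memLp_coeff (hd : π.IsFormalDegree μ d) (g f : H) :
    MemLp (π.coeff g f) 2 μ := by
  rw [memLp_two_iff_lintegral_enorm_sq (π.measurable_coeff g f).aestronglyMeasurable,
    hd.lintegral_enorm_coeff_sq]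
  finiteness

theorem IsFormalDegree.exists_isSchurBounded_enorm_inner_sq (hd : π.IsFormalDegree μ d)
    {ι : Type*} {h : ι → H} {B : ℝ≥0∞} (hB : B ≠ ∞)
    (hh : ∀ f, ∑' i, ‖inner ℂ (h i) f‖ₑ ^ 2 ≤ B * ‖f‖ₑ ^ 2) (g : H) :
    ∃ s : ℝ≥0∞, s ≠ 0 ∧ s ≠ ∞ ∧
      IsSchurBounded μ (fun i x => ‖inner ℂ (h i) (π.op x g)‖ₑ ^ 2) (s ^ 2) := by
  have hnorm (i : ι) : ‖h i‖ₑ ^ 2 ≤ B := by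
    rcases eq_or_ne (h i) 0 with hi | hi
    · simp [hi]
    refine (ENNReal.mul_le_mul_iff_left (pow_ne_zero 2 (enorm_ne_zero.2 hi)) (by finiteness)).1 ?_
    calc ‖h i‖ₑ ^ 2 * ‖h i‖ₑ ^ 2 = ‖inner ℂ (h i) (h i)‖ₑ ^ 2 := by
          rw [enorm_inner_self, sq (‖h i‖ₑ ^ 2)]
      _ ≤ B * ‖h i‖ₑ ^ 2 := (ENNReal.le_tsum i).trans (hh (h i))
  set s : ℝ≥0∞ := (B + ENNReal.ofReal d⁻¹ * B) * ‖g‖ₑ ^ 2 with hs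
  have hle : s ≤ (s + 1) ^ 2 := le_self_add.trans (le_self_pow₀ le_add_self two_ne_zero)
  refine ⟨s + 1, by simp, by finiteness, IsSchurBounded.mono (s := s)
    ⟨Eventually.of_forall fun x => ?_, fun i => ?_⟩ (fun _ _ => le_rfl) hle⟩
  · refine (hh (π.op x g)).trans ?_
    rw [LinearIsometryEquiv.enorm_map, hs, add_mul]
    exact le_self_add
  · calc ∫⁻ x, ‖inner ℂ (h i) (π.op x g)‖ₑ ^ 2 ∂μ = ∫⁻ x, ‖π.coeff g (h i) x‖ₑ ^ 2 ∂μ := by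
          simp only [coeff, ← ofReal_norm, norm_inner_symm]
      _ = ENNReal.ofReal d⁻¹ * ‖h i‖ₑ ^ 2 * ‖g‖ₑ ^ 2 := hd.lintegral_enorm_coeff_sq g (h i)
      _ ≤ (B + ENNReal.ofReal d⁻¹ * B) * ‖g‖ₑ ^ 2 := by
          gcongr
          exact (mul_le_mul_right (hnorm i) _).trans le_add_self

end

section ReproducingKernel

variable {G H : Type*} [Group G] [TopologicalSpace G] [IsTopologicalGroup G] [T2Space G]
  [LocallyCompactSpace G] [SecondCountableTopology G] [MeasurableSpace G] [BorelSpace G]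
  [NormedAddCommGroup H] [InnerProductSpace ℂ H] {μ : Measure G} {π : ProjectiveRep G H} {d : ℝ}
  {Q Λ : Set G} {g : H} {h : Λ → H} {B B' : ℝ≥0∞}

variable [IsFiniteMeasureOnCompacts μ] [μ.IsMulLeftInvariant] [μ.IsInvInvariant]

theorem IsFormalDegree.exists_isSchurBounded_inner_mul_inner (hd : π.IsFormalDegree μ d)
    (hΛ : IsRelativelySeparated μ Λ) (hQ : IsCompact Q) (hQ₀ : μ Q ≠ 0)
    (hg : MemLp (leftLocalMax μ Q (π.coeff g g)) 2 μ) (hB : B ≠ ∞)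
    (hgB : ∀ f, ∑' l, ‖inner ℂ (π.coherentSystem Λ g l) f‖ₑ ^ 2 ≤ B * ‖f‖ₑ ^ 2) (hB' : B' ≠ ∞)
    (hhB : ∀ f, ∑' l, ‖inner ℂ (h l) f‖ₑ ^ 2 ≤ B' * ‖f‖ₑ ^ 2)
    {Φ : Λ → G → ℂ} (hΦ : Φ = fun l x =>
      inner ℂ (π.op x g) (π.coherentSystem Λ g l) * inner ℂ (h l) (π.op x g)) :
    (∃ β : ℝ≥0∞, β ≠ ∞ ∧ IsSchurBounded μ (fun l x => ‖Φ l x‖ₑ) β) ∧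
      ∀ η : ℝ≥0∞, η ≠ 0 →
        ∃ C, IsCompact C ∧ IsSchurBounded μ (offDiagonal C fun l x => ‖Φ l x‖ₑ) η := by
  obtain ⟨s, -, hs, hgs⟩ := hd.exists_isSchurBounded_enorm_inner_sq hB hgB g
  obtain ⟨t, ht₀, ht, hht⟩ := hd.exists_isSchurBounded_enorm_inner_sq hB' hhB g
  have hmeas (f : H) : AEMeasurable (fun x => ‖inner ℂ f (π.op x g)‖ₑ) μ :=
    (stronglyMeasurable_const.inner (π.stronglyMeasurable g)).enorm.aemeasurable
  have hΦ' (l : Λ) (x : G) : ‖Φ l x‖ₑ =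
      ‖inner ℂ (π.coherentSystem Λ g l) (π.op x g)‖ₑ * ‖inner ℂ (h l) (π.op x g)‖ₑ := by
    rw [hΦ, enorm_mul, ← ofReal_norm, norm_inner_symm, ofReal_norm]
  have hcoeff (l : Λ) (x : G) :
      ‖inner ℂ (π.coherentSystem Λ g l) (π.op x g)‖ₑ = ‖π.coeff g g (x⁻¹ * l)‖ₑ := by
    rw [← ofReal_norm, norm_inner_symm, coherentSystem, norm_inner_op_op, ofReal_norm]
  simp only [hΦ']
  refine ⟨⟨s * t, by finiteness, hgs.mul hht (fun _ => hmeas _) fun _ => hmeas _⟩, fun η hη =>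
    exists_isSchurBounded_offDiagonal_mul (fun ε hε => ?_) hht ht₀ ht
      (fun _ => hmeas _) (fun _ => hmeas _) hη⟩
  simp only [hcoeff]
  exact hΛ.exists_isSchurBounded_offDiagonal hQ hQ₀ (π.measurable_coeff g g)
    (hd.memLp_coeff g g) hg hε

theorem IsFormalDegree.ofReal_le_liminf (hd : π.IsFormalDegree μ d)
    (hΛ : IsRelativelySeparated μ Λ) (hQ : IsCompact Q) (hQ₀ : μ Q ≠ 0)
    (hg : MemLp (leftLocalMax μ Q (π.coeff g g)) 2 μ) (hg₀ : g ≠ 0) (hB : B ≠ ∞)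
    (hgB : ∀ f, ∑' l, ‖inner ℂ (π.coherentSystem Λ g l) f‖ₑ ^ 2 ≤ B * ‖f‖ₑ ^ 2) (hB' : B' ≠ ∞)
    (hhB : ∀ f, ∑' l, ‖inner ℂ (h l) f‖ₑ ^ 2 ≤ B' * ‖f‖ₑ ^ 2)
    (hrec : ∀ f, HasSum (fun l => inner ℂ f (π.coherentSystem Λ g l) * inner ℂ (h l) f)
      (‖f‖ ^ 2 : ℂ)) {K : ℕ → Set G} (hK : IsStrongFolner μ K) :
    ENNReal.ofReal d ≤ liminf (fun n => (∑' l : Λ,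
      (K n).indicator (fun _ => ‖inner ℂ (h l) (π.coherentSystem Λ g l)‖ₑ) (l : G)) / μ (K n))
      atTop := by
  set c : ℝ≥0∞ := ENNReal.ofReal d⁻¹ * ‖g‖ₑ ^ 2 with hc
  obtain ⟨⟨β, hβ', hβ⟩, hoff⟩ :=
    hd.exists_isSchurBounded_inner_mul_inner hΛ hQ hQ₀ hg hB hgB hB' hhB rfl
  have hliminf := hK.enorm_le_liminf_of_isSchurBounded hΛ (r := (‖g‖ ^ 2 : ℂ))
    (fun l => (hd.2 _ (h l) g g).1) (Eventually.of_forall fun x => by simpa using hrec (π.op x g))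
    hβ hβ' hoff
  have hmean (n : ℕ) : (∑' l : Λ, (K n).indicator (fun _ => ‖∫ x, inner ℂ (π.op x g)
      (π.coherentSystem Λ g l) * inner ℂ (h l) (π.op x g) ∂μ‖ₑ) (l : G)) =
      c * ∑' l : Λ, (K n).indicator
        (fun _ => ‖inner ℂ (h l) (π.coherentSystem Λ g l)‖ₑ) (l : G) := by
    simp only [hd.enorm_integral_inner_mul_inner, Set.indicator_const_mul, ENNReal.tsum_mul_left,
      hc]
  have hnorm : c * ENNReal.ofReal d = ‖(‖g‖ ^ 2 : ℂ)‖ₑ := by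
    rw [hc, mul_right_comm, ← ENNReal.ofReal_mul (inv_nonneg.2 hd.1.le),
      inv_mul_cancel₀ hd.1.ne', enorm_pow, enorm_complex_ofReal]
    simp
  refine le_liminf_of_mul_le_liminf_mul (c := c)
    (mul_ne_zero (by simpa using hd.1) (by simpa)) (by finiteness) ?_
  simpa only [hmean, mul_div_assoc, hnorm] using hliminf

end ReproducingKernel

end ProjectiveRep

theorem isInvInvariant_of_isMulRightInvariant {G : Type*} [Group G] [TopologicalSpace G]
    [IsTopologicalGroup G] [LocallyCompactSpace G] [SecondCountableTopology G] [MeasurableSpace G]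
    [BorelSpace G] (μ : Measure G) [μ.IsHaarMeasure] [μ.IsMulRightInvariant] :
    μ.IsInvInvariant := by
  have hinv : μ.inv = Measure.haarScalarFactor μ.inv μ • μ :=
    Measure.isMulLeftInvariant_eq_smul_of_regular μ.inv μ
  obtain ⟨K⟩ : Nonempty (TopologicalSpace.PositiveCompacts G) := inferInstance
  have hS : IsCompact (K ∪ K⁻¹ : Set G) := K.isCompact.union K.isCompact.inv
  have hSpos : μ (K ∪ K⁻¹) ≠ 0 :=
    (Measure.measure_pos_of_nonempty_interior μ
      (K.interior_nonempty.mono (interior_mono Set.subset_union_left))).ne'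
  have hfactor : (Measure.haarScalarFactor μ.inv μ : ℝ≥0∞) = 1 := by
    refine (ENNReal.mul_eq_right hSpos hS.measure_lt_top.ne).1 ?_
    calc Measure.haarScalarFactor μ.inv μ * μ (K ∪ K⁻¹) = μ.inv (K ∪ K⁻¹) :=
          (congrArg (fun ν : Measure G => ν (K ∪ K⁻¹)) hinv).symm
      _ = μ (K ∪ K⁻¹) := by rw [Measure.inv_apply, Set.union_inv, inv_inv, Set.union_comm]
  exact ⟨by rw [hinv, ENNReal.coe_eq_one.1 hfactor, one_smul]⟩

theorem sesqForm_ext_of_self {E : Type*} [AddCommGroup E] [Module ℂ E]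
    {S T : E →ₗ⋆[ℂ] E →ₗ[ℂ] ℂ} (h : ∀ a, S a a = T a a) : S = T := by
  have hsymm (a b : E) : S a b + S b a = T a b + T b a := by
    have hab := h (a + b)
    simp only [map_add, LinearMap.add_apply] at hab
    linear_combination hab - h a - h b
  ext a b
  have hI := hsymm a (Complex.I • b)
  simp only [map_smul, map_smulₛₗ, LinearMap.smul_apply, smul_eq_mul, Complex.conj_I] at hI
  refine mul_left_cancel₀ (mul_ne_zero two_ne_zero Complex.I_ne_zero) ?_
  linear_combination hI + Complex.I * hsymm a b

theorem integral_inner_mul_inner_of_self {X E F : Type*} [MeasurableSpace X] {μ : Measure X}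
    [NormedAddCommGroup E] [InnerProductSpace ℂ E] [NormedAddCommGroup F] [InnerProductSpace ℂ F]
    {U : X → E →ₗ[ℂ] F} (hU : ∀ f₁ f₂ g₁ g₂,
      Integrable (fun x => inner ℂ (U x g₁) f₁ * inner ℂ f₂ (U x g₂)) μ) {k : ℂ}
    (hk : ∀ f g, ∫ x, inner ℂ (U x g) f * inner ℂ f (U x g) ∂μ = k * inner ℂ f f * inner ℂ g g)
    (f₁ f₂ : F) (g₁ g₂ : E) :
    ∫ x, inner ℂ (U x g₁) f₁ * inner ℂ f₂ (U x g₂) ∂μ = k * inner ℂ f₂ f₁ * inner ℂ g₁ g₂ := by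
  have hpolar_right (g : E) : LinearMap.mk₂'ₛₗ (starRingEnd ℂ) (RingHom.id ℂ)
      (fun a b => ∫ x, inner ℂ (U x g) b * inner ℂ a (U x g) ∂μ)
      (fun a b c => by simp only [inner_add_left, mul_add, integral_add, hU])
      (fun z a b => by simp only [inner_smul_left, mul_left_comm _ (conj z),
        integral_const_mul, smul_eq_mul])
      (fun a b c => by simp only [inner_add_right, add_mul, integral_add, hU])
      (fun z a b => by simp only [inner_smul_right, mul_assoc, integral_const_mul, smul_eq_mul,
        RingHom.id_apply]) = (k * inner ℂ g g) • innerₛₗ ℂ :=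
    sesqForm_ext_of_self fun a => (hk a g).trans (mul_right_comm _ _ _)
  have hpolar_left : LinearMap.mk₂'ₛₗ (starRingEnd ℂ) (RingHom.id ℂ)
      (fun a b => ∫ x, inner ℂ (U x a) f₁ * inner ℂ f₂ (U x b) ∂μ)
      (fun a b c => by simp only [map_add, inner_add_left, add_mul, integral_add, hU])
      (fun z a b => by simp only [map_smul, inner_smul_left, mul_assoc, integral_const_mul,
        smul_eq_mul])
      (fun a b c => by simp only [map_add, inner_add_right, mul_add, integral_add, hU])
      (fun z a b => by simp only [map_smul, inner_smul_right, mul_left_comm, integral_const_mul,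
        smul_eq_mul, RingHom.id_apply]) = (k * inner ℂ f₂ f₁) • innerₛₗ ℂ :=
    sesqForm_ext_of_self fun a =>
      (LinearMap.congr_fun₂ (hpolar_right a) f₂ f₁).trans (mul_right_comm _ _ _)
  exact LinearMap.congr_fun₂ hpolar_left g₁ g₂

theorem exists_cfc_mul_cfc_eq_zero {A : Type*} [CStarAlgebra A] {a : A} (ha : IsSelfAdjoint a)
    (hs : ¬ (spectrum ℝ a).Subsingleton) :
    ∃ p q : ℝ → ℝ, cfc p a ≠ 0 ∧ cfc q a ≠ 0 ∧ cfc p a * cfc q a = 0 := by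
  obtain ⟨α, hα, β, hβ, hαβ⟩ := (Set.not_subsingleton_iff.1 hs).exists_lt
  obtain ⟨γ, hαγ, hγβ⟩ := exists_between hαβ
  have hne {r : ℝ → ℝ} (hr : Continuous r) {t : ℝ} (ht : t ∈ spectrum ℝ a) (hrt : r t ≠ 0) :
      cfc r a ≠ 0 := fun h0 =>
    hrt (eqOn_of_cfc_eq_cfc (g := 0) (h0.trans (cfc_zero ℝ a).symm) hr.continuousOn
      continuousOn_const ha ht)
  refine ⟨fun t => max 0 (γ - t), fun t => max 0 (t - γ),
    hne (by fun_prop) hα (lt_max_of_lt_right (sub_pos.2 hαγ)).ne',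
    hne (by fun_prop) hβ (lt_max_of_lt_right (sub_pos.2 hγβ)).ne', ?_⟩
  rw [← cfc_mul _ _ a, ← cfc_zero ℝ a]
  congr 1
  ext t
  rcases le_total t γ with h | h <;> simp [h]

namespace ProjectiveRep

section Schur

variable {G H : Type*} [Group G] [MeasurableSpace G] [NormedAddCommGroup H] [InnerProductSpace ℂ H]
  {π : ProjectiveRep G H}

theorem IsIrreducible.exists_eq_smul [CompleteSpace H] (hπ : π.IsIrreducible) {P : H →L[ℂ] H}
    (hP : IsSelfAdjoint P) (hcomm : ∀ x f, P (π.op x f) = π.op x (P f)) :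
    ∃ c : ℝ, ∀ f, P f = (c : ℂ) • f := by
  by_cases hs : (spectrum ℝ P).Subsingleton
  · obtain ⟨c, hc⟩ : ∃ c, spectrum ℝ P ⊆ {c} := hs.eq_empty_or_singleton.elim
      (fun h => ⟨0, h.subset.trans (Set.empty_subset _)⟩) fun ⟨c, h⟩ => ⟨c, h.subset⟩
    exact ⟨c, DFunLike.congr_fun (CFC.eq_algebraMap_of_spectrum_subset_singleton P c hc)⟩
  obtain ⟨p, q, hp, hq, hpq⟩ := exists_cfc_mul_cfc_eq_zero hP hs
  have hpcomm (x : G) (f : H) : cfc p P (π.op x f) = π.op x (cfc p P f) :=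
    have hPx : Commute P ((π.op x).toContinuousLinearEquiv : H →L[ℂ] H) :=
      ContinuousLinearMap.ext fun f => hcomm x f
    DFunLike.congr_fun (hP.commute_cfc hPx p) f
  have hker (x : G) (f : H) (hf : f ∈ (cfc p P).ker) : π.op x f ∈ (cfc p P).ker := by
    rw [LinearMap.mem_ker] at hf ⊢
    exact (hpcomm x f).trans ((congrArg _ hf).trans (map_zero _))
  rcases hπ (cfc p P).ker (cfc p P).isClosed_ker hker with hbot | htop
  · refine absurd (ContinuousLinearMap.ext fun f => ?_) hq
    exact (Submodule.mem_bot ℂ).1 (hbot ▸ DFunLike.congr_fun hpq f)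
  · refine absurd (ContinuousLinearMap.ext fun f => ?_) hp
    exact (htop ▸ Submodule.mem_top : f ∈ (cfc p P).ker)

variable (π) in
theorem cocycle_smul_op_one (f : H) : (π.cocycle 1 1 : ℂ) • π.op 1 f = f := by
  have h := π.op_mul 1 1 ((π.op 1).symm f)
  rw [mul_one, LinearIsometryEquiv.apply_symm_apply] at h
  exact h.symm

theorem surjective_of_intertwining {X : Type*} [NormedAddCommGroup X] [InnerProductSpace ℂ X]
    {J : X →ₗ[ℂ] H} (hJ : Function.Injective J) {L : G → X →ₗᵢ[ℂ] X}
    (hL : ∀ x ξ, J (L x ξ) = π.op x (J ξ)) (x : G) : Function.Surjective (L x) := fun ξ => by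
  refine ⟨((π.cocycle 1 1 : ℂ) * (π.cocycle x x⁻¹ : ℂ)) • L x⁻¹ ξ, hJ ?_⟩
  rw [hL, map_smul, map_smul, hL, mul_smul, ← π.op_mul, mul_inv_cancel, cocycle_smul_op_one]

theorem IsIrreducible.exists_norm_sq_eq [CompleteSpace H] (hπ : π.IsIrreducible) {X : Type*}
    [NormedAddCommGroup X] [InnerProductSpace ℂ X] [CompleteSpace X] {J : X →L[ℂ] H}
    (hJ : Function.Injective J) (hJ₀ : J ≠ 0) {L : G → X →ₗᵢ[ℂ] X}
    (hL : ∀ x ξ, J (L x ξ) = π.op x (J ξ)) :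
    ∃ a : ℝ, ∀ f, ∃ ξ, J ξ = f ∧ ‖ξ‖ ^ 2 = a * ‖f‖ ^ 2 := by
  have hadj (x : G) (f : H) : L x (J.adjoint f) = J.adjoint (π.op x f) := by
    refine ext_inner_right ℂ fun ξ => ?_
    obtain ⟨ξ, rfl⟩ := surjective_of_intertwining (J := J.toLinearMap) hJ hL x ξ
    rw [ContinuousLinearMap.adjoint_inner_left, LinearIsometry.inner_map_map, hL,
      LinearIsometryEquiv.inner_map_map, ContinuousLinearMap.adjoint_inner_left]
  obtain ⟨c, hc⟩ : ∃ c : ℝ, ∀ f, J (J.adjoint f) = (c : ℂ) • f :=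
    hπ.exists_eq_smul (ContinuousLinearMap.isPositive_self_comp_adjoint J).isSelfAdjoint fun x f =>
      (congrArg J (hadj x f).symm).trans (hL x _)
  have hnorm (f : H) : ‖J.adjoint f‖ ^ 2 = c * ‖f‖ ^ 2 := by
    rw [ContinuousLinearMap.apply_norm_sq_eq_inner_adjoint_left,
      ContinuousLinearMap.adjoint_adjoint, ContinuousLinearMap.comp_apply, hc, inner_smul_left,
      Complex.conj_ofReal]
    simp [← Complex.ofReal_pow]
  have hc₀ : c ≠ 0 := by
    rintro rfl
    refine hJ₀ ?_
    rw [← J.adjoint_adjoint, show J.adjoint = 0 from ContinuousLinearMap.ext fun f => by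
      simpa using hnorm f, map_zero]
  refine ⟨c⁻¹, fun f => ⟨(c : ℂ)⁻¹ • J.adjoint f, ?_, ?_⟩⟩
  · rw [map_smul, hc, inv_smul_smul₀ (by exact_mod_cast hc₀)]
  · rw [norm_smul, mul_pow, hnorm, norm_inv, Complex.norm_real, inv_pow, Real.norm_eq_abs, sq_abs]
    field_simp

end Schur

section

variable {G H : Type*} [Group G] [MeasurableSpace G] [NormedAddCommGroup H] [InnerProductSpace ℂ H]
  (π : ProjectiveRep G H) {μ : Measure G} {g : H}

theorem norm_coeff_inv (f g : H) (x : G) : ‖π.coeff g f x⁻¹‖ = ‖π.coeff f g x‖ := by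
  rw [← mul_one x⁻¹, ← norm_inner_op_op, coeff]
  conv_rhs => rw [← π.cocycle_smul_op_one g]
  rw [inner_smul_right, norm_mul, Circle.norm_coe, one_mul]

theorem lintegral_enorm_coeff_sq_comm [MeasurableInv G] [μ.IsInvInvariant] (f g : H) :
    ∫⁻ x, ‖π.coeff g f x‖ₑ ^ 2 ∂μ = ∫⁻ x, ‖π.coeff f g x‖ₑ ^ 2 ∂μ := by
  rw [← lintegral_inv_eq_self]
  simp only [← ofReal_norm, norm_coeff_inv]

theorem lintegral_enorm_coeff_op_sq [MeasurableMul G] [μ.IsMulLeftInvariant] (f g : H) (x : G) :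
    ∫⁻ y, ‖π.coeff g (π.op x f) y‖ₑ ^ 2 ∂μ = ∫⁻ y, ‖π.coeff g f y‖ₑ ^ 2 ∂μ := by
  rw [← lintegral_mul_left_eq_self (fun y => ‖π.coeff g f y‖ₑ ^ 2) x⁻¹]
  refine lintegral_congr fun y => ?_
  rw [← ofReal_norm, ← ofReal_norm, ← norm_inner_op_op, norm_inner_symm, coeff]

variable (μ g) in
/-- The graph of the coefficient operator `f ↦ V_g f`, restricted to the vectors with
`V_g f ∈ L²`. The sum of the two norms turns it into a Hilbert space to which Schur's lemma
applies. -/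
noncomputable def coeffGraph : Submodule ℂ (WithLp 2 (H × Lp ℂ 2 μ)) where
  carrier := {p | p.snd =ᵐ[μ] π.coeff g p.fst}
  add_mem' := fun {p q} hp hq => by
    refine (Lp.coeFn_add p.snd q.snd).trans ?_
    filter_upwards [hp, hq] with x hpx hqx
    exact (congrArg₂ _ hpx hqx).trans (inner_add_right _ _ _).symm
  zero_mem' := (Lp.coeFn_zero ℂ 2 μ).trans (Eventually.of_forall fun _ =>
    (inner_zero_right _).symm)
  smul_mem' := fun z p hp => by
    refine (Lp.coeFn_smul z p.snd).trans ?_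
    filter_upwards [hp] with x hpx
    exact (congrArg _ hpx).trans (inner_smul_right _ _ _).symm

variable (μ g) in
theorem isClosed_coeffGraph : IsClosed (π.coeffGraph μ g : Set (WithLp 2 (H × Lp ℂ 2 μ))) := by
  refine IsSeqClosed.isClosed fun p q hp hpq => ?_
  have hfst : Tendsto (fun n => (p n).fst) atTop (𝓝 q.fst) :=
    ((WithLp.fstL 2 ℂ H (Lp ℂ 2 μ)).continuous.tendsto q).comp hpq
  have hsnd : Tendsto (fun n => (p n).snd) atTop (𝓝 q.snd) :=
    ((WithLp.sndL 2 ℂ H (Lp ℂ 2 μ)).continuous.tendsto q).comp hpq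
  obtain ⟨ns, hns, hlim⟩ := (tendstoInMeasure_of_tendsto_Lp hsnd).exists_seq_tendsto_ae
  change q.snd =ᵐ[μ] π.coeff g q.fst
  filter_upwards [hlim, ae_all_iff.2 hp] with x hx hpx
  have hcoeff : Tendsto (fun n => π.coeff g (p (ns n)).fst x) atTop (𝓝 (π.coeff g q.fst x)) :=
    tendsto_const_nhds.inner (hfst.comp hns.tendsto_atTop)
  exact tendsto_nhds_unique hx (hcoeff.congr fun n => (hpx (ns n)).symm)

variable {π}

theorem enorm_coeffGraph_sq (ξ : π.coeffGraph μ g) : ‖ξ‖ₑ ^ 2 =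
    ‖ξ.1.fst‖ₑ ^ 2 + ∫⁻ x, ‖π.coeff g ξ.1.fst x‖ₑ ^ 2 ∂μ := by
  have hsnd : ‖ξ.1.snd‖ₑ ^ 2 = ∫⁻ x, ‖π.coeff g ξ.1.fst x‖ₑ ^ 2 ∂μ := by
    rw [Lp.enorm_def, eLpNorm_congr_ae ξ.2,
      eLpNorm_eq_lintegral_rpow_enorm_toReal two_ne_zero ENNReal.ofNat_ne_top,
      ← ENNReal.rpow_natCast, ← ENNReal.rpow_mul]
    simp
  have hnorm : ‖ξ‖ ^ 2 = ‖ξ.1.fst‖ ^ 2 + ‖ξ.1.snd‖ ^ 2 := WithLp.prod_norm_sq_eq_of_L2 ξ.1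
  rw [← hsnd]
  simp only [← ofReal_norm, ← ENNReal.ofReal_pow (norm_nonneg _)]
  rw [hnorm, ENNReal.ofReal_add (sq_nonneg _) (sq_nonneg _)]

theorem exists_coeffGraph_fst_eq {f : H} (hf : ∫⁻ x, ‖π.coeff g f x‖ₑ ^ 2 ∂μ ≠ ∞) :
    ∃ ξ : π.coeffGraph μ g, ξ.1.fst = f :=
  have hmem := (memLp_two_iff_lintegral_enorm_sq (π.measurable_coeff g f).aestronglyMeasurable).2 hf
  ⟨⟨WithLp.toLp 2 (f, hmem.toLp _), hmem.coeFn_toLp⟩, rfl⟩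

theorem lintegral_enorm_coeff_coeffGraph_ne_top (ξ : π.coeffGraph μ g) :
    ∫⁻ x, ‖π.coeff g ξ.1.fst x‖ₑ ^ 2 ∂μ ≠ ∞ :=
  ne_top_of_le_ne_top (by finiteness) (le_add_self.trans_eq (enorm_coeffGraph_sq ξ).symm)

theorem coeffGraph_fst_injective : Function.Injective fun ξ : π.coeffGraph μ g => ξ.1.fst := by
  intro ξ η h
  have hfst : (ξ - η).1.fst = 0 := sub_eq_zero.2 h
  have hnorm := enorm_coeffGraph_sq (ξ - η)
  simp only [hfst, coeff, inner_zero_right, enorm_zero, zero_pow two_ne_zero, lintegral_zero,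
    add_zero, sq_eq_zero_iff] at hnorm
  exact sub_eq_zero.1 (enorm_eq_zero.1 hnorm)

theorem exists_coeffGraph_linearIsometry [MeasurableMul G] [μ.IsMulLeftInvariant] (x : G) :
    ∃ L : π.coeffGraph μ g →ₗᵢ[ℂ] π.coeffGraph μ g, ∀ ξ, (L ξ).1.fst = π.op x ξ.1.fst := by
  choose U hU using fun ξ : π.coeffGraph μ g => exists_coeffGraph_fst_eq
    ((π.lintegral_enorm_coeff_op_sq ξ.1.fst g x).trans_ne
      (lintegral_enorm_coeff_coeffGraph_ne_top ξ))
  refine ⟨{ toFun := U, map_add' := fun ξ η => coeffGraph_fst_injective ?_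
            map_smul' := fun z ξ => coeffGraph_fst_injective ?_, norm_map' := fun ξ => ?_ }, hU⟩
  · simp [hU]
  · simp [hU]
  · refine enorm_eq_iff_norm_eq.1 (ENNReal.pow_right_strictMono two_ne_zero |>.injective ?_)
    change ‖U ξ‖ₑ ^ 2 = ‖ξ‖ₑ ^ 2
    rw [enorm_coeffGraph_sq, enorm_coeffGraph_sq, hU, lintegral_enorm_coeff_op_sq,
      LinearIsometryEquiv.enorm_map]

theorem IsIrreducible.exists_lintegral_enorm_coeff_sq_eq [CompleteSpace H] [MeasurableMul G]
    [μ.IsMulLeftInvariant] (hπ : π.IsIrreducible) {f₀ : H} (hf₀ : f₀ ≠ 0)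
    (hgf : ∫⁻ x, ‖π.coeff g f₀ x‖ₑ ^ 2 ∂μ ≠ ∞) :
    ∃ C : ℝ≥0∞, C ≠ ∞ ∧ ∀ f, ∫⁻ x, ‖π.coeff g f x‖ₑ ^ 2 ∂μ = C * ‖f‖ₑ ^ 2 := by
  have : CompleteSpace (π.coeffGraph μ g) := (π.isClosed_coeffGraph μ g).completeSpace_coe
  let J : π.coeffGraph μ g →L[ℂ] H := WithLp.fstL 2 ℂ H (Lp ℂ 2 μ) ∘L (π.coeffGraph μ g).subtypeL
  have hJ₀ : J ≠ 0 := fun h => by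
    obtain ⟨ξ, rfl⟩ := exists_coeffGraph_fst_eq hgf
    exact hf₀ (DFunLike.congr_fun h ξ)
  choose L hL using exists_coeffGraph_linearIsometry (π := π) (μ := μ) (g := g)
  obtain ⟨a, ha⟩ := hπ.exists_norm_sq_eq (J := J) coeffGraph_fst_injective hJ₀ hL
  refine ⟨ENNReal.ofReal a - 1, by finiteness, fun f => ?_⟩
  obtain ⟨ξ, rfl, hξ⟩ := ha f
  have hξ' : ‖ξ‖ₑ ^ 2 = ENNReal.ofReal a * ‖J ξ‖ₑ ^ 2 := by
    simp only [← ofReal_norm, ← ENNReal.ofReal_pow (norm_nonneg _)]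
    rw [hξ, ENNReal.ofReal_mul' (sq_nonneg _)]
  rw [ENNReal.sub_mul fun _ _ => by finiteness, one_mul, ← hξ', enorm_coeffGraph_sq]
  exact (ENNReal.add_sub_cancel_left (by finiteness)).symm

end

section

variable {G H : Type*} [Group G] [MeasurableSpace G] [NormedAddCommGroup H] [InnerProductSpace ℂ H]
  {π : ProjectiveRep G H} {μ : Measure G}

theorem exists_not_coeff_ae_eq_zero [CompleteSpace H] [NeZero μ] {g : H} (hg : g ≠ 0) :
    ∃ f, ¬ π.coeff g f =ᵐ[μ] 0 := by
  by_contra! h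
  have hzero : (fun x => π.op x g) =ᵐ[μ] 0 := by
    refine ae_eq_zero_of_forall_dual_of_isSeparable ℂ (π.stronglyMeasurable g).isSeparable_range
      (fun L => ?_) (Eventually.of_forall fun x => Set.mem_range_self x)
    filter_upwards [h ((InnerProductSpace.toDual ℂ H).symm L)] with x hx
    rw [← InnerProductSpace.toDual_symm_apply, ← inner_conj_symm]
    exact (congrArg conj hx).trans (map_zero _)
  obtain ⟨x, hx⟩ := hzero.exists
  exact hg ((map_eq_zero_iff (π.op x) (π.op x).injective).1 hx)

theorem isFormalDegree_of_lintegral_enorm_coeff_sq {k : ℝ≥0∞} (hk₀ : k ≠ 0) (hk : k ≠ ∞)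
    (h : ∀ f g, ∫⁻ x, ‖π.coeff g f x‖ₑ ^ 2 ∂μ = k * ‖f‖ₑ ^ 2 * ‖g‖ₑ ^ 2) :
    π.IsFormalDegree μ k.toReal⁻¹ := by
  have hmem (f g : H) : MemLp (π.coeff g f) 2 μ := by
    rw [memLp_two_iff_lintegral_enorm_sq (π.measurable_coeff g f).aestronglyMeasurable, h]
    finiteness
  have hint (f₁ f₂ g₁ g₂ : H) :
      Integrable (fun x => inner ℂ (π.op x g₁) f₁ * inner ℂ f₂ (π.op x g₂)) μ := by
    simpa only [← inner_conj_symm f₂] using! (hmem f₁ g₁).integrable_mul (hmem f₂ g₂).star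
  have hself (f g : H) : ∫ x, inner ℂ (π.op x g) f * inner ℂ f (π.op x g) ∂μ =
      k.toReal * inner ℂ f f * inner ℂ g g := by
    have hsq (x : G) : inner ℂ (π.op x g) f * inner ℂ f (π.op x g) =
        ((‖π.coeff g f x‖ₑ ^ 2).toReal : ℂ) := by
      rw [← inner_conj_symm f, Complex.mul_conj', coeff]
      simp
    simp only [hsq, integral_complex_ofReal, inner_self_eq_norm_sq_to_K]
    rw [integral_toReal ((π.measurable_coeff g f).enorm.pow_const 2).aemeasurable
      (Eventually.of_forall fun x => by finiteness), h]
    simp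
  refine ⟨inv_pos.2 (ENNReal.toReal_pos hk₀ hk), fun f₁ f₂ g₁ g₂ => ⟨hint f₁ f₂ g₁ g₂, ?_⟩⟩
  rw [inner_conj_symm, Complex.ofReal_inv, inv_inv]
  exact integral_inner_mul_inner_of_self
    (U := fun x => ((π.op x).toLinearEquiv : H →ₗ[ℂ] H)) hint hself f₁ f₂ g₁ g₂

theorem IsDiscreteSeries.exists_lintegral_enorm_coeff_sq_eq [CompleteSpace H] [MeasurableMul G]
    [MeasurableInv G] [NeZero μ] [μ.IsMulLeftInvariant] [μ.IsInvInvariant]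
    (hπ : π.IsDiscreteSeries μ) : ∃ k : ℝ≥0∞, k ≠ 0 ∧ k ≠ ∞ ∧
      ∀ f g, ∫⁻ x, ‖π.coeff g f x‖ₑ ^ 2 ∂μ = k * ‖f‖ₑ ^ 2 * ‖g‖ₑ ^ 2 := by
  obtain ⟨hirr, g₀, hg₀, hmem⟩ := hπ
  have hg₀' : ‖g₀‖ₑ ^ 2 ≠ 0 := pow_ne_zero 2 (enorm_ne_zero.2 hg₀)
  obtain ⟨C₀, hC₀, hcoeff₀⟩ := hirr.exists_lintegral_enorm_coeff_sq_eq hg₀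
    ((memLp_two_iff_lintegral_enorm_sq hmem.1).1 hmem)
  have hcoeff (f g : H) :
      ∫⁻ x, ‖π.coeff g f x‖ₑ ^ 2 ∂μ = C₀ / ‖g₀‖ₑ ^ 2 * ‖f‖ₑ ^ 2 * ‖g‖ₑ ^ 2 := by
    have hg : ∫⁻ x, ‖π.coeff g g₀ x‖ₑ ^ 2 ∂μ = C₀ * ‖g‖ₑ ^ 2 := by
      rw [lintegral_enorm_coeff_sq_comm, hcoeff₀]
    obtain ⟨C, -, hC⟩ := hirr.exists_lintegral_enorm_coeff_sq_eq (μ := μ) (g := g) hg₀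
      (by rw [hg]; finiteness)
    have hC' : C = C₀ * ‖g‖ₑ ^ 2 / ‖g₀‖ₑ ^ 2 :=
      (ENNReal.eq_div_iff hg₀' (by finiteness)).2 ((mul_comm _ _).trans ((hC g₀).symm.trans hg))
    rw [hC f, hC', ENNReal.mul_div_right_comm, mul_right_comm]
  refine ⟨C₀ / ‖g₀‖ₑ ^ 2, fun h0 => ?_, ENNReal.div_ne_top hC₀ hg₀', hcoeff⟩
  obtain ⟨f, hf⟩ := exists_not_coeff_ae_eq_zero (π := π) (μ := μ) hg₀
  have hzero := hcoeff f g₀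
  rw [h0, zero_mul, zero_mul,
    lintegral_eq_zero_iff ((π.measurable_coeff g₀ f).enorm.pow_const 2)] at hzero
  exact hf (hzero.mono fun x hx => by simpa using hx)

theorem IsDiscreteSeries.isFormalDegree_formalDegree [CompleteSpace H] [MeasurableMul G]
    [MeasurableInv G] [NeZero μ] [μ.IsMulLeftInvariant] [μ.IsInvInvariant]
    (hπ : π.IsDiscreteSeries μ) : π.IsFormalDegree μ (π.formalDegree μ) := by
  obtain ⟨k, hk₀, hk, h⟩ := hπ.exists_lintegral_enorm_coeff_sq_eq
  have hex : ∃ d, π.IsFormalDegree μ d := ⟨_, isFormalDegree_of_lintegral_enorm_coeff_sq hk₀ hk h⟩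
  rw [formalDegree, dif_pos hex]
  exact hex.choose_spec

end

theorem isRelativelySeparated_of_tsum_enorm_inner_sq_le {G H : Type*} [Group G]
    [TopologicalSpace G] [MeasurableSpace G] [NormedAddCommGroup H] [InnerProductSpace ℂ H]
    [CompleteSpace H] {π : ProjectiveRep G H} {μ : Measure G} [NeZero μ] [μ.InnerRegular]
    {Λ : Set G} {g : H} (hg : g ≠ 0) {B : ℝ≥0∞} (hB : B ≠ ∞)
    (hgB : ∀ f, ∑' l, ‖inner ℂ (π.coherentSystem Λ g l) f‖ₑ ^ 2 ≤ B * ‖f‖ₑ ^ 2) :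
    IsRelativelySeparated μ Λ := by
  obtain ⟨f, hf⟩ := exists_not_coeff_ae_eq_zero (π := π) (μ := μ) hg
  obtain ⟨δ, hδ, hpos⟩ : ∃ δ : ℝ≥0∞, 0 < δ ∧ μ {x | δ ≤ ‖π.coeff g f x‖ₑ} ≠ 0 := by
    by_contra! h
    exact hf (((ae_le_const_iff_forall_gt_measure_zero _ _).2 h).mono fun x hx => by simpa using hx)
  obtain ⟨E, hEδ, hE, hE₀⟩ := (measurableSet_le measurable_const
    (π.measurable_coeff g f).enorm).exists_lt_isCompact (pos_iff_ne_zero.2 hpos)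
  have hδ₀ : δ ^ 2 ≠ 0 := pow_ne_zero 2 hδ.ne'
  refine ⟨E, hE, hE₀.ne', B * ‖f‖ₑ ^ 2 / δ ^ 2, ENNReal.div_ne_top (by finiteness) hδ₀,
    fun x => (ENNReal.le_div_iff_mul_le (Or.inl hδ₀) (Or.inr (by finiteness))).2 ?_⟩
  calc ((Λ ∩ x • E).encard : ℝ≥0∞) * δ ^ 2
      = ∑' l : Λ, (x • E).indicator 1 (l : G) * δ ^ 2 := by
        rw [ENNReal.tsum_mul_right, tsum_indicator_one_eq_encard]
    _ ≤ ∑' l : Λ, ‖inner ℂ (π.coherentSystem Λ g l) (π.op x f)‖ₑ ^ 2 := by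
        refine ENNReal.tsum_le_tsum fun l => ?_
        by_cases hl : (l : G) ∈ x • E
        · rw [← ofReal_norm, norm_inner_symm, coherentSystem, norm_inner_op_op, ofReal_norm,
            Set.indicator_of_mem hl, Pi.one_apply, one_mul]
          gcongr
          exact hEδ (Set.mem_smul_set_iff_inv_smul_mem.1 hl)
        · simp [hl]
    _ ≤ B * ‖f‖ₑ ^ 2 := (hgB _).trans_eq (by rw [LinearIsometryEquiv.enorm_map])

end ProjectiveRep

theorem lt_limsup_of_add_mul_le {α : Type*} {f : Filter α} [f.NeBot] {a ε : ℝ≥0∞}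
    {u v w : α → ℝ≥0∞} (ha : a ≠ ∞) (hu : a ≤ liminf u f) (hε : ε ≠ 0) (hv : 0 < liminf v f)
    (h : ∀ n, u n + ε * v n ≤ w n) : a < limsup w f := by
  obtain ⟨c, hc, hcv⟩ := exists_between hv
  calc a < a + ε * c := ENNReal.lt_add_right ha (mul_ne_zero hε hc.ne')
    _ ≤ liminf u f + ε * c := by gcongr
    _ = liminf (fun n => u n + ε * c) f :=
        (liminf_add_const f u _ (by isBoundedDefault) (by isBoundedDefault)).symm
    _ ≤ liminf w f := liminf_le_liminf <| (eventually_lt_of_lt_liminf hcv).mono fun n hn =>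
        (by gcongr : u n + ε * c ≤ u n + ε * v n).trans (h n)
    _ ≤ limsup w f := liminf_le_limsup

theorem tsum_indicator_add_mul_encard_le {α : Type*} {Λ Γ : Set α} (hΓΛ : Γ ⊆ Λ) (S : Set α)
    {a : Λ → ℝ≥0∞} {ε : ℝ≥0∞} (ha : ∀ l, a l ≤ 1) (haΓ : ∀ l : Λ, (l : α) ∈ Γ → a l + ε ≤ 1) :
    ∑' l : Λ, S.indicator (fun _ => a l) (l : α) + ε * ((Γ ∩ S).encard : ℝ≥0∞) ≤
      ((Λ ∩ S).encard : ℝ≥0∞) := by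
  have hΓS : Γ ∩ S = Λ ∩ (Γ ∩ S) := by
    rw [← Set.inter_assoc, Set.inter_eq_right.2 hΓΛ]
  rw [hΓS, ← tsum_indicator_one_eq_encard, ← tsum_indicator_one_eq_encard, ← ENNReal.tsum_mul_left,
    ← ENNReal.tsum_add]
  refine ENNReal.tsum_le_tsum fun l => ?_
  by_cases hS : (l : α) ∈ S <;> by_cases hΓ : (l : α) ∈ Γ <;> simp [hS, hΓ, ha, haΓ]

theorem IsFrame.exists_enorm_inner_canonicalDual_self_add_le_one {α H : Type*}
    [NormedAddCommGroup H] [InnerProductSpace ℂ H] [CompleteSpace H] {Λ Γ : Set α} {v : α → H}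
    {r : ℝ} (hv : IsFrame fun l : Λ => v l) (hvΓ : IsFrame fun l : ↑(Λ \ Γ) => v l)
    (hr : ∀ x, ‖v x‖ ≤ r) :
    ∃ ε : ℝ≥0∞, ε ≠ 0 ∧ ∀ l : Λ, (l : α) ∈ Γ → ‖inner ℂ (hv.canonicalDual l) (v l)‖ₑ + ε ≤ 1 := by
  obtain ⟨ρ, hρ, hle⟩ := hv.exists_lt_one_norm_inner_canonicalDual_self_le
    (Set.inclusion_injective Set.sdiff_subset) hvΓ (fun l => hr l)
  refine ⟨ENNReal.ofReal (1 - ρ), by simpa using hρ, fun l hl => ?_⟩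
  have hl' := hle l (by rw [Set.range_inclusion]; exact fun h => h.2 hl)
  rw [← ofReal_norm, ← ENNReal.ofReal_add (norm_nonneg _) (by linarith), ENNReal.ofReal_le_one]
  linarith

end CoherentFrame

open CoherentFrame in
theorem proposition4p3_general {G H : Type*}
    [Group G] [TopologicalSpace G] [IsTopologicalGroup G] [T2Space G] [LocallyCompactSpace G]
    [SecondCountableTopology G] [MeasurableSpace G] [BorelSpace G]
    [NormedAddCommGroup H] [InnerProductSpace ℂ H] [CompleteSpace H]
    (μ : Measure G) [μ.IsHaarMeasure] [μ.IsMulRightInvariant]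
    (Q : Set G) (hQ : IsCompact Q) (hQ₀ : μ Q ≠ 0)
    (π : ProjectiveRep G H) (hπ : π.IsDiscreteSeries μ) (Λ : Set G)
    (g : H) (hg : MemLp (leftLocalMax μ Q (π.coeff g g)) 2 μ)
    (hframe : IsFrame (π.coherentSystem Λ g))
    (K : ℕ → Set G) (hK : IsStrongFolner μ K)
    (hremove : ∃ Γ ⊆ Λ, IsRelativelyDense Γ ∧ IsFrame (π.coherentSystem (Λ \ Γ) g)) :
    ENNReal.ofReal (π.formalDegree μ) < upperBeurlingDensity μ K Λ := by
  obtain ⟨Γ, hΓΛ, hΓ, hΓframe⟩ := hremove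
  have : Nontrivial H := hπ.2.elim fun g' hg' => nontrivial_of_ne g' 0 hg'.1
  have := isInvInvariant_of_isMulRightInvariant μ
  have hg₀ : g ≠ 0 := by
    obtain ⟨l, hl⟩ := hframe.exists_ne_zero
    simpa [ProjectiveRep.coherentSystem] using hl
  obtain ⟨B, hB, hgB⟩ := hframe.exists_tsum_enorm_inner_sq_le
  obtain ⟨B', hB', hhB⟩ := hframe.exists_tsum_enorm_inner_canonicalDual_sq_le
  have hΛ : IsRelativelySeparated μ Λ :=
    π.isRelativelySeparated_of_tsum_enorm_inner_sq_le hg₀ hB hgB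
  obtain ⟨ε, hε, hdiag⟩ := hframe.exists_enorm_inner_canonicalDual_self_add_le_one
    (v := fun x => π.op x g) hΓframe fun x => ((π.op x).norm_map g).le
  have hdual (l : Λ) : ‖inner ℂ (hframe.canonicalDual l) (π.op l g)‖ₑ ≤ 1 :=
    (ofReal_norm _).ge.trans
      (ENNReal.ofReal_le_one.2 (hframe.norm_inner_canonicalDual_self_le_one l))
  have hmean := hπ.isFormalDegree_formalDegree.ofReal_le_liminf hΛ hQ hQ₀ hg hg₀ hB hgB hB' hhB
    hframe.hasSum_inner_mul_inner_canonicalDual hK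
  have hΓK := hΓ.liminf_pos (hΛ.mono hΓΛ) hK
  refine lt_limsup_of_add_mul_le ENNReal.ofReal_ne_top hmean hε hΓK fun n => le_iSup_of_le 1 ?_
  rw [one_smul, ← mul_div_assoc, ← ENNReal.add_div]
  gcongr
  exact tsum_indicator_add_mul_encard_le hΓΛ (K n) hdual hdiag

theorem proposition4p3 {G H : Type*}
    [Group G] [TopologicalSpace G] [IsTopologicalGroup G] [T2Space G] [LocallyCompactSpace G]
    [SecondCountableTopology G] [MeasurableSpace G] [BorelSpace G]
    [NormedAddCommGroup H] [InnerProductSpace ℂ H] [CompleteSpace H]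
    -- a Haar measure of the unimodular group `G`
    (μ : Measure G) [μ.IsHaarMeasure] [μ.IsMulRightInvariant]
    -- the compact symmetric unit neighbourhood used for local maximal functions
    (Q : Set G) (hQ : IsCompact Q) (hQ_symm : Q⁻¹ = Q) (hQ_nhds : Q ∈ 𝓝 (1 : G))
    (π : CoherentFrame.ProjectiveRep G H) (hπ : π.IsDiscreteSeries μ)
    (Λ : Set G) (hΛ : DiscreteTopology Λ)
    (g : H) (hg : g ∈ π.B2 μ Q)
    (hframe : CoherentFrame.IsFrame (π.coherentSystem Λ g))
    -- `G` is amenable, and both densities may be computed along arbitrary, possibly different,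
    -- strong Folner sequences
    (K K' : ℕ → Set G) (hK : CoherentFrame.IsStrongFolner μ K)
    (hK' : CoherentFrame.IsStrongFolner μ K')
    (hremove : ∃ Γ : Set G, Γ ⊆ Λ ∧ 0 < CoherentFrame.lowerBeurlingDensity μ K Γ ∧
      CoherentFrame.IsFrame (π.coherentSystem (Λ \ Γ) g)) :
    ENNReal.ofReal (π.formalDegree μ) < CoherentFrame.upperBeurlingDensity μ K' Λ := by
  obtain ⟨Γ, hΓΛ, hΓ, hΓframe⟩ := hremove
  exact proposition4p3_general μ Q hQ (Measure.measure_pos_of_mem_nhds μ hQ_nhds).ne' π hπ Λ g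
    hg.2 hframe K' hK'
    ⟨Γ, hΓΛ, CoherentFrame.isRelativelyDense_of_lowerBeurlingDensity_pos hK.isCompact hΓ, hΓframe⟩
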